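/- For $\nu>0$ and $\alpha\in\mathbb Z$ consider the Stokes problem for the $\alpha$-th Fourier mode on the half-line, $$\partial_t\omega=\nu(\partial_z^2-\alpha^2)\omega\quad (t>0,\ z>0),\qquad \nu\,\omega(t,0)=-\int_0^\infty e^{-|\alpha| z}\,\omega(t,z)\,dz\quad(t>0).$$ A Green function of this problem is a real function $G_\alpha(t,z,y)$, $t>0$, $z,y\ge 0$, such that for each fixed $y\ge0$: (i) $(t,z)\mapsto G_\alpha(t,z,y)$ is continuous on $(0,\infty)\times[0,\infty)$, is differentiable in $t$ with $\partial_tG_\alpha$ jointly continuous in $(t,z)$ and twice continuously differentiable in $z$ for $t,z>0$, satisfies the equation there, and $\sup_{0<t\le T}\int_0^\infty|G_\alpha(t,z,y)|\,dz<\infty$ for every $T>0$; (ii) it satisfies the nonlocal boundary condition for every $t>0$; (iii) $G_\alpha(0,\cdot,y)=\delta_y$, that is, $\int_0^\infty G_\alpha(t,z,y)\varphi(z)\,dz\to\varphi(y)$ as $t\to0^+$ for every bounded continuous $\varphi$ on $[0,\infty)$, where for $y=0$ only those $\varphi$ with $\varphi(0)=0$ are used. **Proposition.** For all $\nu>0$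 and $\alpha\in\mathbb Z$ there is exactly one Green function $G_\alpha$, and $$G_\alpha(t,z,y)=H_\alpha(t,z,y)+R_\alpha(t,z,y),\qquad t>0,\ z,y\ge0,$$ where $$H_\alpha(t,z,y)=\frac1{\sqrt{4\pi\nu t}}\Big(e^{-\frac{|y-z|^2}{4\nu t}}+e^{-\frac{|y+z|^2}{4\nu t}}\Big)e^{-\alpha^2\nu t}$$ is the heat kernel of $\partial_t-\nu(\partial_z^2-\alpha^2)$ on the half-line with the homogeneous Neumann condition, meaning that it satisfies (i), that $\partial_zH_\alpha(t,0,y)=0$ for $t>0$, $y\ge0$, and that it satisfies (iii) with all bounded continuous $\varphi$ for every $y\ge0$. The residual kernel $R_\alpha(t,z,y)$ is $C^\infty$ in $z\in[0,\infty)$, and there are $\theta_0>0$ and constants $C_k$ $(k=0,1,2,\dots)$, independent of $\nu,\alpha,t,z,y$, such that $$|\partial_z^kR_\alpha(t,z,y)|\le C_k\,(\nu t)^{-k/2}\,e^{-\theta_0\alpha^2\nu t}\,(\nu t)^{-1/2}\,e^{-\theta_0\frac{z^2}{4\nu t}}$$ for all $\nu>0$, $\alpha\in\mathbb Z$, $t>0$,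 $y,z\ge0$ and $k\ge0$ (one-sided derivatives at $z=0$). -/

import Mathlib

open Set Filter Topology MeasureTheory
open scoped ContDiff BoundedContinuousFunction

/-- `g(t,z)` is a classical solution of the heat equation
`∂ₜ g = ν (∂_z² - α²) g` in `t > 0`, `z > 0`, continuous up to the boundary `z = 0`,
whose `L¹(0,∞)` norm in `z` stays bounded on every time interval `(0,T]`.
(Continuity of `∂_z² g` follows from the equation.) -/
structure IsL1HeatSolution (ν : ℝ) (α : ℤ) (g : ℝ → ℝ → ℝ) : Prop where
  continuousOn : ContinuousOn (fun p : ℝ × ℝ => g p.1 p.2) (Ioi 0 ×ˢ Ici 0)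
  differentiableAt_time : ∀ t > 0, ∀ z > 0, DifferentiableAt ℝ (fun s => g s z) t
  continuousOn_time_deriv :
    ContinuousOn (fun p : ℝ × ℝ => deriv (fun s => g s p.2) p.1) (Ioi 0 ×ˢ Ioi 0)
  contDiffOn_space : ∀ t > 0, ContDiffOn ℝ 2 (g t) (Ioi 0)
  equation : ∀ t > 0, ∀ z > 0,
    deriv (fun s => g s z) t = ν * (iteratedDeriv 2 (g t) z - (α : ℝ) ^ 2 * g t z)
  l1_bounded : ∀ T > 0, ∃ M : ℝ, ∀ t, 0 < t → t ≤ T →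
    IntegrableOn (g t) (Ioi 0) ∧ ∫ z in Ioi (0 : ℝ), |g t z| ≤ M

/-- `G(t,z,y)` is a Green function of the Stokes problem for the `α`-th Fourier mode,
`∂ₜ ω = ν (∂_z² - α²) ω` in `z > 0`, `ν ω(0) = - ∫₀^∞ e^{-|α| z} ω(z) dz`:
for each `y ≥ 0` it is a solution in `(t,z)` satisfying the nonlocal boundary condition, with
initial datum the Dirac mass `δ_y`, attained weakly against bounded continuous functions on
`[0,∞)`. For `y = 0` the test functions are those vanishing at `0`, i.e. `δ_0` is
seen from the open half-line: a Dirac mass sitting on the boundary itself is incompatible with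
the boundary condition. -/
structure IsStokesGreen (ν : ℝ) (α : ℤ) (G : ℝ → ℝ → ℝ → ℝ) : Prop where
  solution : ∀ y ≥ 0, IsL1HeatSolution ν α (fun t z => G t z y)
  boundary : ∀ y ≥ 0, ∀ t > 0,
    ν * G t 0 y = -∫ z in Ioi (0 : ℝ), Real.exp (-(|(α : ℝ)| * z)) * G t z y
  initial : ∀ y ≥ 0, ∀ φ : ℝ →ᵇ ℝ, (y = 0 → φ 0 = 0) →
    Tendsto (fun t => ∫ z in Ioi (0 : ℝ), G t z y * φ z) (𝓝[>] 0) (𝓝 (φ y))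

/-- `G(t,z,y)` is a heat kernel of `∂ₜ - ν (∂_z² - α²)` on the half-line with the
homogeneous Neumann boundary condition `∂_z G(t,0,y) = 0`. -/
structure IsNeumannGreen (ν : ℝ) (α : ℤ) (G : ℝ → ℝ → ℝ → ℝ) : Prop where
  solution : ∀ y ≥ 0, IsL1HeatSolution ν α (fun t z => G t z y)
  boundary : ∀ y ≥ 0, ∀ t > 0, HasDerivWithinAt (fun z => G t z y) 0 (Ici 0) 0
  initial : ∀ y ≥ 0, ∀ φ : ℝ →ᵇ ℝ,
    Tendsto (fun t => ∫ z in Ioi (0 : ℝ), G t z y * φ z) (𝓝[>] 0) (𝓝 (φ y))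

/-- `H_α(t,z,y) = (4πνt)^{-1/2} (e^{-|y-z|²/(4νt)} + e^{-|y+z|²/(4νt)}) e^{-α²νt}`. -/
noncomputable def stokesH (ν : ℝ) (α : ℤ) (t z y : ℝ) : ℝ :=
  1 / Real.sqrt (4 * Real.pi * ν * t) *
    (Real.exp (-(|y - z| ^ 2 / (4 * ν * t))) + Real.exp (-(|y + z| ^ 2 / (4 * ν * t)))) *
    Real.exp (-((α : ℝ) ^ 2 * ν * t))

/-!
Extending a datum from the half-line to the line turns the Stokes problem into the heat equation
without boundary. In the variable `τ = νt`, with `a = |α|`, `c = 1/ν` and the Gaussian kernel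
`g(τ, x) = (4πτ)^{-1/2} e^{-x²/(4τ)}`, the Laplace transform in time suggests
`G_α = e^{-a²τ} [g(z - y) - g(z + y) + 2 ∫_0^∞ k(p) ∂_z g(z + p) dp]`
with an explicit weight `k` (`stokesWeight`). Three properties of `k` carry the existence and the
estimates. First, `0 ≤ k ≤ 1` for all parameters; since the sources `-p` lie to the left of the
half-line, the superposition (`heatSup`) decays like a Gaussian in `z` with constants independent
of `ν`, `α` and `y` (`abs_residualJet_le`). Second, `k(p) ≤ c p`, so the superposition does not
contribute to the initial datum (`tendsto_integral_residualJet`). Third, the integrand that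
expresses the boundary condition is an exact derivative on both sides of `p = y`
(`integral_stokesWeight_mul_of_hasDerivAt`), which gives `stokes_boundary_jet`. At `y = 0` the
weight vanishes and so does `G_α`.

Uniqueness uses no kernels. Let `u` be a solution with vanishing initial datum. Testing with
`e^{-az} - e^{-μz}`, which vanishes at the boundary, makes the unknown normal derivative disappear
(`IsL1HeatSolution.weak_form`), and the nonlocal condition closes the identity to
`W' = κ W - (κ + μ - a) F`, where `κ = ν(μ² - a²)`, `W = ∫ (e^{-az} - e^{-μz}) u` and
`F = ∫ e^{-az} u`. As `W` is bounded independently of `μ`, the integrals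
`∫_0^T e^{κ(T-s)} F(s) ds` are bounded as `κ → ∞`. This forces `F = 0` on `(0, T)`
(`eq_zero_of_exp_moments`), hence `W = 0` for every `μ`, so the Laplace transform of `u(t, ·)`
vanishes, and `u = 0` by the same lemma.
-/

/-! ### Derivatives of the Gaussian -/

/-- The `n`-th derivative of the normalised Gaussian `u ↦ (4π)^{-1/2} e^{-u²/4}`, defined through
the three-term recurrence of the Hermite functions; `hasDerivAt_gaussDeriv` shows that this is
the iterated derivative. -/
noncomputable def gaussDeriv : ℕ → ℝ → ℝ
  | 0, u => (Real.sqrt (4 * Real.pi))⁻¹ * Real.exp (-(u ^ 2 / 4))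
  | 1, u => -(u / 2) * ((Real.sqrt (4 * Real.pi))⁻¹ * Real.exp (-(u ^ 2 / 4)))
  | n + 2, u => -(u / 2) * gaussDeriv (n + 1) u - ((n : ℝ) + 1) / 2 * gaussDeriv n u

theorem hasDerivAt_gaussDeriv (n : ℕ) (u : ℝ) :
    HasDerivAt (gaussDeriv n) (gaussDeriv (n + 1) u) u := by
  have key : ∀ n : ℕ, (∀ u, HasDerivAt (gaussDeriv n) (gaussDeriv (n + 1) u) u) ∧
      ∀ u, HasDerivAt (gaussDeriv (n + 1)) (gaussDeriv (n + 2) u) u := by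
    intro n
    have h0 : ∀ u, HasDerivAt (gaussDeriv 0) (gaussDeriv 1 u) u := by
      intro u
      have h1 : HasDerivAt (fun u : ℝ => -(u ^ 2 / 4)) (-(u / 2)) u := by
        refine ((hasDerivAt_pow 2 u).div_const 4).fun_neg.congr_deriv ?_
        norm_num
        ring
      refine ((h1.exp).const_mul (Real.sqrt (4 * Real.pi))⁻¹).congr_deriv ?_
      simp only [gaussDeriv]
      ring
    have hlin : ∀ u : ℝ, HasDerivAt (fun u : ℝ => -(u / 2)) (-(1 / 2)) u := fun u =>
      ((hasDerivAt_id u).div_const 2).fun_neg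
    induction n with
    | zero =>
      refine ⟨h0, fun u => ?_⟩
      refine ((hlin u).fun_mul (h0 u)).congr_deriv ?_
      simp only [gaussDeriv]
      push_cast
      ring
    | succ n ih =>
      refine ⟨ih.2, fun u => ?_⟩
      have := ((hlin u).mul (ih.2 u)).sub ((ih.1 u).const_mul (((n : ℝ) + 1) / 2))
      have e : gaussDeriv (n + 2) = (fun u => -(u / 2)) * gaussDeriv (n + 1)
          - fun u => ((n : ℝ) + 1) / 2 * gaussDeriv n u := by
        funext u
        simp [gaussDeriv]
      change HasDerivAt (gaussDeriv (n + 2)) (gaussDeriv (n + 3) u) u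
      rw [e]
      refine this.congr_deriv ?_
      have e3 : gaussDeriv (n + 3) u = -(u / 2) * gaussDeriv (n + 2) u
        - (((n + 1 : ℕ) : ℝ) + 1) / 2 * gaussDeriv (n + 1) u := rfl
      rw [e3]
      push_cast
      ring
  exact (key n).1 u

theorem continuous_gaussDeriv (n : ℕ) : Continuous (gaussDeriv n) :=
  continuous_iff_continuousAt.2 fun u => (hasDerivAt_gaussDeriv n u).continuousAt

theorem gaussDeriv_zero_neg (u : ℝ) : gaussDeriv 0 (-u) = gaussDeriv 0 u := by
  simp [gaussDeriv]

theorem gaussDeriv_one_neg (u : ℝ) : gaussDeriv 1 (-u) = -gaussDeriv 1 u := by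
  simp only [gaussDeriv, neg_sq]
  ring

theorem exists_gaussDeriv_le_pow (n : ℕ) :
    ∃ C : ℝ, 0 ≤ C ∧ ∀ u, |gaussDeriv n u| ≤ C * (1 + |u|) ^ n * Real.exp (-(u ^ 2 / 4)) := by
  have key : ∀ n : ℕ, (∃ C : ℝ, 0 ≤ C ∧ ∀ u,
      |gaussDeriv n u| ≤ C * (1 + |u|) ^ n * Real.exp (-(u ^ 2 / 4))) ∧
      ∃ C : ℝ, 0 ≤ C ∧ ∀ u,
      |gaussDeriv (n + 1) u| ≤ C * (1 + |u|) ^ (n + 1) * Real.exp (-(u ^ 2 / 4)) := by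
    intro n
    induction n with
    | zero =>
      refine ⟨⟨(Real.sqrt (4 * Real.pi))⁻¹, by positivity, fun u => ?_⟩,
        ⟨(Real.sqrt (4 * Real.pi))⁻¹, by positivity, fun u => ?_⟩⟩
      · simp only [gaussDeriv, pow_zero, mul_one]
        exact (abs_of_nonneg (by positivity)).le
      · simp only [gaussDeriv, zero_add, pow_one, abs_mul, abs_neg, Real.abs_exp]
        rw [← mul_assoc, abs_of_nonneg (a := (Real.sqrt (4 * Real.pi))⁻¹) (by positivity),
          mul_comm (|u / 2|)]
        gcongr
        rw [abs_div, abs_two]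
        linarith [abs_nonneg u]
    | succ n ih =>
      refine ⟨ih.2, ?_⟩
      obtain ⟨⟨C, hC, h⟩, ⟨C', hC', h'⟩⟩ := ih
      refine ⟨C' + ((n : ℝ) + 1) * C, by positivity, fun u => ?_⟩
      have e : gaussDeriv (n + 2) u = -(u / 2) * gaussDeriv (n + 1) u
        - ((n : ℝ) + 1) / 2 * gaussDeriv n u := rfl
      have hu := abs_nonneg u
      have hn : (0 : ℝ) ≤ (n : ℝ) + 1 := by positivity
      calc |gaussDeriv (n + 2) u|
          ≤ |u| / 2 * |gaussDeriv (n + 1) u| + ((n : ℝ) + 1) / 2 * |gaussDeriv n u| := by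
            rw [e]
            refine (abs_sub _ _).trans ?_
            rw [abs_mul, abs_mul, abs_neg, abs_div, abs_two,
              abs_of_nonneg (a := ((n : ℝ) + 1) / 2) (by positivity)]
        _ ≤ (1 + |u|) * (C' * (1 + |u|) ^ (n + 1) * Real.exp (-(u ^ 2 / 4))) +
            ((n : ℝ) + 1) * (C * (1 + |u|) ^ (n + 2) * Real.exp (-(u ^ 2 / 4))) := by
            refine add_le_add (mul_le_mul (by linarith) (h' u) (abs_nonneg _) (by positivity))
              (mul_le_mul (by linarith) ((h u).trans ?_) (abs_nonneg _) hn)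
            gcongr
            · linarith
            · omega
        _ = _ := by ring
  exact (key n).1

/-- Halving the rate of the Gaussian absorbs the polynomial factor of its derivatives. -/
theorem exists_gaussDeriv_le (n : ℕ) :
    ∃ C : ℝ, 0 ≤ C ∧ ∀ u, |gaussDeriv n u| ≤ C * Real.exp (-(u ^ 2 / 8)) := by
  obtain ⟨C, hC, h⟩ := exists_gaussDeriv_le_pow n
  refine ⟨C * (n.factorial * Real.exp 3), by positivity, fun u => (h u).trans ?_⟩
  have h1 : (1 + |u|) ^ n ≤ n.factorial * Real.exp (1 + |u|) := by
    have := Real.pow_div_factorial_le_exp (1 + |u|) (by positivity) n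
    rwa [div_le_iff₀ (by positivity), mul_comm] at this
  have h2 : Real.exp (1 + |u|) ≤ Real.exp 3 * Real.exp (u ^ 2 / 8) := by
    rw [← Real.exp_add]
    refine Real.exp_le_exp.2 ?_
    nlinarith [sq_nonneg (|u| - 4), sq_abs u]
  calc C * (1 + |u|) ^ n * Real.exp (-(u ^ 2 / 4))
      ≤ C * (n.factorial * (Real.exp 3 * Real.exp (u ^ 2 / 8))) * Real.exp (-(u ^ 2 / 4)) := by
        gcongr
        exact h1.trans (by gcongr)
    _ = C * (n.factorial * Real.exp 3) * (Real.exp (u ^ 2 / 8) * Real.exp (-(u ^ 2 / 4))) := by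
        ring
    _ = _ := by
        rw [← Real.exp_add]
        congr 2
        ring

/-! ### The heat kernel of the line and its space derivatives -/

/-- The `n`-th space derivative of the heat kernel `(4πτ)^{-1/2} e^{-x²/(4τ)}` of the line, written
in the similarity variable `x / √τ`. -/
noncomputable def heatD (n : ℕ) (τ x : ℝ) : ℝ :=
  (Real.sqrt τ)⁻¹ ^ (n + 1) * gaussDeriv n (x * (Real.sqrt τ)⁻¹)

theorem hasDerivAt_heatD_space (n : ℕ) (τ x : ℝ) :
    HasDerivAt (heatD n τ) (heatD (n + 1) τ x) x := by
  have h1 : HasDerivAt (fun x : ℝ => x * (Real.sqrt τ)⁻¹) (Real.sqrt τ)⁻¹ x := by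
    simpa using (hasDerivAt_id x).mul_const (Real.sqrt τ)⁻¹
  refine (((hasDerivAt_gaussDeriv n (x * (Real.sqrt τ)⁻¹)).comp x h1).const_mul
    ((Real.sqrt τ)⁻¹ ^ (n + 1))).congr_deriv ?_
  simp only [heatD]
  ring

theorem hasDerivAt_inv_sqrt {τ : ℝ} (hτ : 0 < τ) :
    HasDerivAt (fun τ : ℝ => (Real.sqrt τ)⁻¹) (-(1 / 2) * (Real.sqrt τ)⁻¹ ^ 3) τ := by
  have hs : 0 < Real.sqrt τ := Real.sqrt_pos.2 hτ
  refine ((Real.hasDerivAt_sqrt hτ.ne').fun_inv hs.ne').congr_deriv ?_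
  field_simp

/-- The heat equation for all space derivatives of the kernel. -/
theorem hasDerivAt_heatD_time (n : ℕ) {τ : ℝ} (hτ : 0 < τ) (x : ℝ) :
    HasDerivAt (fun τ => heatD n τ x) (heatD (n + 2) τ x) τ := by
  have h1 := hasDerivAt_inv_sqrt hτ
  refine ((h1.fun_pow (n + 1)).fun_mul
    ((hasDerivAt_gaussDeriv n (x * (Real.sqrt τ)⁻¹)).comp τ (h1.const_mul x))).congr_deriv ?_
  have e : ∀ u, gaussDeriv (n + 2) u = -(u / 2) * gaussDeriv (n + 1) u
        - ((n : ℝ) + 1) / 2 * gaussDeriv n u := fun u => rfl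
  simp only [heatD, e, Function.comp]
  push_cast
  ring

theorem heatD_zero_neg (τ x : ℝ) : heatD 0 τ (-x) = heatD 0 τ x := by
  simp [heatD, neg_mul, gaussDeriv_zero_neg]

theorem heatD_one_neg (τ x : ℝ) : heatD 1 τ (-x) = -heatD 1 τ x := by
  simp [heatD, neg_mul, gaussDeriv_one_neg]

theorem heatD_zero_eq {τ : ℝ} (hτ : 0 < τ) (x : ℝ) :
    heatD 0 τ x = 1 / Real.sqrt (4 * Real.pi * τ) * Real.exp (-(x ^ 2 / (4 * τ))) := by
  have hs : 0 < Real.sqrt τ := Real.sqrt_pos.2 hτ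
  simp only [heatD, gaussDeriv, zero_add, pow_one]
  rw [Real.sqrt_mul (by positivity) τ, mul_pow, inv_pow, Real.sq_sqrt hτ.le]
  have : x ^ 2 * τ⁻¹ / 4 = x ^ 2 / (4 * τ) := by field_simp
  rw [this]
  field_simp

theorem continuousOn_heatD (n : ℕ) :
    ContinuousOn (fun p : ℝ × ℝ => heatD n p.1 p.2) (Ioi 0 ×ˢ univ) := by
  have h1 : ContinuousOn (fun p : ℝ × ℝ => (Real.sqrt p.1)⁻¹) (Ioi 0 ×ˢ univ) :=
    ContinuousOn.inv₀ (by fun_prop) fun p hp => (Real.sqrt_pos.2 hp.1).ne'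
  exact (h1.pow _).mul ((continuous_gaussDeriv n).comp_continuousOn
    (continuousOn_snd.mul h1))

theorem continuous_heatD (n : ℕ) (τ : ℝ) : Continuous (heatD n τ) :=
  continuous_iff_continuousAt.2 fun x => (hasDerivAt_heatD_space n τ x).continuousAt

/-- A constant in the Gaussian bound of `gaussDeriv n`. -/
noncomputable def gaussConst (n : ℕ) : ℝ := (exists_gaussDeriv_le n).choose

theorem gaussConst_nonneg (n : ℕ) : 0 ≤ gaussConst n := (exists_gaussDeriv_le n).choose_spec.1

theorem abs_heatD_le (n : ℕ) {τ : ℝ} (hτ : 0 < τ) (x : ℝ) :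
    |heatD n τ x| ≤ gaussConst n * (Real.sqrt τ)⁻¹ ^ (n + 1) * Real.exp (-(x ^ 2 / (8 * τ))) := by
  have h := (exists_gaussDeriv_le n).choose_spec.2 (x * (Real.sqrt τ)⁻¹)
  have e : (x * (Real.sqrt τ)⁻¹) ^ 2 / 8 = x ^ 2 / (8 * τ) := by
    rw [mul_pow, inv_pow, Real.sq_sqrt hτ.le]
    field_simp
  rw [e] at h
  rw [heatD, abs_mul, abs_of_nonneg (a := (Real.sqrt τ)⁻¹ ^ (n + 1)) (by positivity)]
  calc _ ≤ (Real.sqrt τ)⁻¹ ^ (n + 1) * (gaussConst n * Real.exp (-(x ^ 2 / (8 * τ)))) := by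
        gcongr
        exact h
    _ = _ := by ring

theorem integrable_exp_neg_sq_div {τ : ℝ} (hτ : 0 < τ) (y : ℝ) :
    Integrable fun x : ℝ => Real.exp (-((x + y) ^ 2 / (8 * τ))) := by
  have := (integrable_exp_neg_mul_sq (b := (8 * τ)⁻¹) (by positivity)).comp_add_right y
  refine this.congr (Eventually.of_forall fun x => ?_)
  simp only
  congr 1
  ring

theorem integral_exp_neg_sq_div {τ : ℝ} (hτ : 0 < τ) (y : ℝ) :
    ∫ x : ℝ, Real.exp (-((x + y) ^ 2 / (8 * τ))) = Real.sqrt (8 * Real.pi) * Real.sqrt τ := by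
  rw [integral_add_right_eq_self (fun x : ℝ => Real.exp (-(x ^ 2 / (8 * τ)))) y]
  have := integral_gaussian (8 * τ)⁻¹
  rw [← Real.sqrt_mul (by positivity)]
  have e : ∀ x : ℝ, -(x ^ 2 / (8 * τ)) = -(8 * τ)⁻¹ * x ^ 2 := fun x => by ring
  simp only [e, this]
  congr 1
  field_simp

theorem integrable_heatD (n : ℕ) {τ : ℝ} (hτ : 0 < τ) (y : ℝ) :
    Integrable fun x : ℝ => heatD n τ (x + y) := by
  refine Integrable.mono' ((integrable_exp_neg_sq_div hτ y).const_mul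
    (gaussConst n * (Real.sqrt τ)⁻¹ ^ (n + 1))) ?_ (Eventually.of_forall fun x => ?_)
  · exact ((continuous_heatD n τ).comp (by fun_prop)).aestronglyMeasurable
  · exact abs_heatD_le n hτ (x + y)

theorem integral_gaussDeriv_zero : ∫ u : ℝ, gaussDeriv 0 u = 1 := by
  simp only [gaussDeriv]
  rw [integral_const_mul]
  have := integral_gaussian (4 : ℝ)⁻¹
  have e : (fun u : ℝ => Real.exp (-(u ^ 2 / 4))) = fun u => Real.exp (-(4 : ℝ)⁻¹ * u ^ 2) := by
    funext u
    congr 1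
    ring
  rw [e, this]
  have h2 : Real.pi / 4⁻¹ = 4 * Real.pi := by ring
  rw [h2]
  exact inv_mul_cancel₀ (by positivity)

/-- A Gaussian bound for `heatD n`, uniform in a neighbourhood of a given time and point; it
justifies differentiating and passing to the limit under integrals of `heatD`. -/
theorem exists_heatD_locally_dominated (n : ℕ) {τ₀ : ℝ} (hτ₀ : 0 < τ₀) (x₀ : ℝ) :
    ∃ B : ℝ → ℝ, Integrable B ∧ ∀ τ ∈ Ioo (τ₀ / 2) (2 * τ₀), ∀ x ∈ Ioo (x₀ - 1) (x₀ + 1),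
      ∀ p, |heatD n τ (x + p)| ≤ B p := by
  refine ⟨fun p => gaussConst n * (Real.sqrt (τ₀ / 2))⁻¹ ^ (n + 1) *
    (Real.exp (1 / (16 * τ₀)) * Real.exp (-((p + x₀) ^ 2 / (8 * (4 * τ₀))))), ?_, ?_⟩
  · exact ((integrable_exp_neg_sq_div (by positivity) x₀).const_mul _).const_mul _
  · intro τ hτ x hx p
    have hτ0 : 0 < τ := lt_trans (by positivity) hτ.1
    have h1 : (Real.sqrt τ)⁻¹ ≤ (Real.sqrt (τ₀ / 2))⁻¹ := by
      have : 0 < Real.sqrt (τ₀ / 2) := Real.sqrt_pos.2 (by positivity)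
      gcongr
      exact hτ.1.le
    refine (abs_heatD_le n hτ0 (x + p)).trans ?_
    have hc := gaussConst_nonneg n
    simp only [← Real.exp_add]
    gcongr
    have h2 : (x + p) ^ 2 / (16 * τ₀) ≤ (x + p) ^ 2 / (8 * τ) :=
      div_le_div_of_nonneg_left (sq_nonneg _) (by positivity) (by linarith [hτ.2])
    have h3 : (p + x₀) ^ 2 / (8 * (4 * τ₀)) ≤ 1 / (16 * τ₀) + (x + p) ^ 2 / (16 * τ₀) := by
      rw [← add_div, div_le_div_iff₀ (by positivity) (by positivity)]
      have : (x - x₀) ^ 2 ≤ 1 := by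
        rw [sq_le_one_iff_abs_le_one, abs_le]
        constructor <;> linarith [hx.1, hx.2]
      have : (p + x₀) ^ 2 ≤ 2 * (1 + (x + p) ^ 2) := by
        nlinarith [sq_nonneg (x + p + (x - x₀))]
      nlinarith
    linarith

/-! ### Jets of solutions of the heat equation -/

/-- `D n` is the `n`-th space derivative of the solution `D 0` of `∂_τ D = ∂_z² D` on
`τ > 0`, `z ∈ ℝ`, all of them jointly continuous. -/
structure HeatJet (D : ℕ → ℝ → ℝ → ℝ) : Prop where
  space : ∀ n, ∀ τ > 0, ∀ z, HasDerivAt (D n τ) (D (n + 1) τ z) z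
  time : ∀ n, ∀ τ > 0, ∀ z, HasDerivAt (fun τ => D n τ z) (D (n + 2) τ z) τ
  cont : ∀ n, ContinuousOn (fun p : ℝ × ℝ => D n p.1 p.2) (Ioi 0 ×ˢ univ)

theorem heatJet_heatD (y : ℝ) : HeatJet fun n τ z => heatD n τ (z + y) where
  space n τ _ z := by
    simpa using (hasDerivAt_heatD_space n τ (z + y)).comp_add_const z y
  time n _ hτ z := hasDerivAt_heatD_time n hτ (z + y)
  cont n := (continuousOn_heatD n).comp (f := fun p : ℝ × ℝ => (p.1, p.2 + y))
    (by fun_prop) fun _ hp => ⟨hp.1, mem_univ _⟩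

theorem HeatJet.add {D E : ℕ → ℝ → ℝ → ℝ} (hD : HeatJet D) (hE : HeatJet E) :
    HeatJet fun n τ z => D n τ z + E n τ z where
  space n τ hτ z := (hD.space n τ hτ z).add (hE.space n τ hτ z)
  time n τ hτ z := (hD.time n τ hτ z).add (hE.time n τ hτ z)
  cont n := (hD.cont n).add (hE.cont n)

theorem HeatJet.const_mul {D : ℕ → ℝ → ℝ → ℝ} (hD : HeatJet D) (c : ℝ) :
    HeatJet fun n τ z => c * D n τ z where
  space n τ hτ z := (hD.space n τ hτ z).const_mul c
  time n τ hτ z := (hD.time n τ hτ z).const_mul c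
  cont n := continuousOn_const.mul (hD.cont n)

theorem HeatJet.shift {D : ℕ → ℝ → ℝ → ℝ} (hD : HeatJet D) :
    HeatJet fun n τ z => D (n + 1) τ z where
  space n := hD.space (n + 1)
  time n := hD.time (n + 1)
  cont n := hD.cont (n + 1)

theorem HeatJet.iteratedDeriv_eq {D : ℕ → ℝ → ℝ → ℝ} (hD : HeatJet D) {τ : ℝ} (hτ : 0 < τ)
    (n : ℕ) : iteratedDeriv n (D 0 τ) = D n τ := by
  induction n with
  | zero => simp
  | succ n ih =>
    rw [iteratedDeriv_succ, ih]
    exact funext fun z => (hD.space n τ hτ z).deriv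

theorem HeatJet.contDiff {D : ℕ → ℝ → ℝ → ℝ} (hD : HeatJet D) {τ : ℝ} (hτ : 0 < τ) :
    ContDiff ℝ ∞ (D 0 τ) := by
  refine contDiff_of_differentiable_iteratedDeriv fun n _ => ?_
  rw [hD.iteratedDeriv_eq hτ]
  exact fun z => (hD.space n τ hτ z).differentiableAt

/-! ### Superpositions of translated heat kernels -/

/-- The superposition `∫_0^∞ k(p) ∂_zⁿ g(τ, z + p) dp` of translates of the heat kernel `g`, whose
sources sit on the left half-line. -/
noncomputable def heatSup (k : ℝ → ℝ) (n : ℕ) (τ z : ℝ) : ℝ :=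
  ∫ p in Ioi (0 : ℝ), k p * heatD n τ (z + p)

section Superposition

variable {k : ℝ → ℝ}

theorem integrableOn_heatSup (hk : Measurable k) (hk1 : ∀ p > 0, |k p| ≤ 1) (n : ℕ) {τ : ℝ}
    (hτ : 0 < τ) (z : ℝ) : IntegrableOn (fun p => k p * heatD n τ (z + p)) (Ioi 0) := by
  have h := (integrable_heatD n hτ z).integrableOn (s := Ioi (0 : ℝ))
  refine (h.bdd_mul (f := k) (c := 1) hk.aestronglyMeasurable ?_).congr ?_
  · filter_upwards [ae_restrict_mem measurableSet_Ioi] with p hp using hk1 p hp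
  · exact Eventually.of_forall fun p => by simp [add_comm]

theorem heatJet_heatSup (hk : Measurable k) (hk1 : ∀ p > 0, |k p| ≤ 1) :
    HeatJet (heatSup k) := by
  have meas : ∀ n, ∀ τ z : ℝ, AEStronglyMeasurable (fun p => k p * heatD n τ (z + p))
      (volume.restrict (Ioi 0)) := fun n τ z =>
    (hk.mul ((continuous_heatD n τ).comp (continuous_const.add continuous_id)).measurable
      ).aestronglyMeasurable
  have bd : ∀ n, ∀ τ z : ℝ, ∀ p > 0, ∀ b, |heatD n τ (z + p)| ≤ b →
      ‖k p * heatD n τ (z + p)‖ ≤ b := by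
    intro n τ z p hp b hb
    rw [norm_mul, Real.norm_eq_abs, Real.norm_eq_abs]
    calc _ ≤ 1 * b := mul_le_mul (hk1 p hp) hb (abs_nonneg _) zero_le_one
      _ = b := one_mul b
  constructor
  · intro n τ hτ z
    obtain ⟨B, hB, hle⟩ := exists_heatD_locally_dominated (n + 1) hτ z
    refine (hasDerivAt_integral_of_dominated_loc_of_deriv_le (s := Ioo (z - 1) (z + 1))
      (F' := fun x p => k p * heatD (n + 1) τ (x + p)) (bound := B)
      (Ioo_mem_nhds (by linarith) (by linarith)) (Eventually.of_forall fun x => meas n τ x)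
      (integrableOn_heatSup hk hk1 n hτ z) (meas (n + 1) τ z) ?_ hB.integrableOn ?_).2
    · filter_upwards [ae_restrict_mem measurableSet_Ioi] with p hp x hx
      exact bd _ _ _ p hp _ (hle τ ⟨by linarith, by linarith⟩ x hx p)
    · refine Eventually.of_forall fun p x _ => ?_
      exact ((hasDerivAt_heatD_space n τ (x + p)).comp_add_const x p).const_mul (k p)
  · intro n τ hτ z
    obtain ⟨B, hB, hle⟩ := exists_heatD_locally_dominated (n + 2) hτ z
    refine (hasDerivAt_integral_of_dominated_loc_of_deriv_le (s := Ioo (τ / 2) (2 * τ))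
      (F := fun τ p => k p * heatD n τ (z + p))
      (F' := fun τ p => k p * heatD (n + 2) τ (z + p)) (bound := B)
      (Ioo_mem_nhds (by linarith) (by linarith)) (Eventually.of_forall fun x => meas n x z)
      (integrableOn_heatSup hk hk1 n hτ z) (meas (n + 2) τ z) ?_ hB.integrableOn ?_).2
    · filter_upwards [ae_restrict_mem measurableSet_Ioi] with p hp x hx
      exact bd _ _ _ p hp _ (hle x hx z ⟨by linarith, by linarith⟩ p)
    · refine Eventually.of_forall fun p x hx => ?_
      exact (hasDerivAt_heatD_time n (by linarith [hx.1]) (z + p)).const_mul (k p)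
  · rintro n ⟨τ, z⟩ ⟨hτ, -⟩
    have hτ : 0 < τ := hτ
    obtain ⟨B, hB, hle⟩ := exists_heatD_locally_dominated n hτ z
    refine ContinuousAt.continuousWithinAt ?_
    refine MeasureTheory.continuousAt_of_dominated (F := fun (q : ℝ × ℝ) p => k p * heatD n q.1 (q.2 + p))
      (bound := B)
      (Eventually.of_forall fun q => meas n q.1 q.2) ?_ hB.integrableOn ?_
    · have : Ioo (τ / 2) (2 * τ) ×ˢ Ioo (z - 1) (z + 1) ∈ 𝓝 (τ, z) :=
        prod_mem_nhds (Ioo_mem_nhds (by linarith) (by linarith))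
          (Ioo_mem_nhds (by linarith) (by linarith))
      filter_upwards [this] with q hq
      filter_upwards [ae_restrict_mem measurableSet_Ioi] with p hp
      exact bd _ _ _ p hp _ (hle q.1 hq.1 q.2 hq.2 p)
    · refine Eventually.of_forall fun p => ?_
      refine ContinuousAt.mul continuousAt_const ?_
      have h := (heatJet_heatD p).cont n
      exact h.continuousAt (prod_mem_nhds (Ioi_mem_nhds hτ) univ_mem)

theorem integral_Ioi_exp_neg_sq_div_le {τ : ℝ} (hτ : 0 < τ) (y : ℝ) :
    ∫ x in Ioi (0 : ℝ), Real.exp (-((x + y) ^ 2 / (8 * τ))) ≤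
      Real.sqrt (8 * Real.pi) * Real.sqrt τ := by
  rw [← integral_exp_neg_sq_div hτ y]
  exact setIntegral_le_integral (integrable_exp_neg_sq_div hτ y)
    (Eventually.of_forall fun x => (Real.exp_pos _).le)

/-- Since the sources lie on the left half-line, the superposition inherits the Gaussian decay
on the right half-line; integrating in `p` gains one power of `√τ`. -/
theorem abs_heatSup_le (hk1 : ∀ p > 0, |k p| ≤ 1) (n : ℕ) {τ : ℝ} (hτ : 0 < τ) {z : ℝ}
    (hz : 0 ≤ z) :
    |heatSup k n τ z| ≤ gaussConst n * Real.sqrt (8 * Real.pi) * (Real.sqrt τ)⁻¹ ^ n *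
      Real.exp (-(z ^ 2 / (8 * τ))) := by
  have hs : 0 < Real.sqrt τ := Real.sqrt_pos.2 hτ
  set c := gaussConst n * (Real.sqrt τ)⁻¹ ^ (n + 1) * Real.exp (-(z ^ 2 / (8 * τ))) with hc
  have hc0 : 0 ≤ c := by have := gaussConst_nonneg n; positivity
  have h1 : |heatSup k n τ z| ≤
      ∫ p in Ioi (0 : ℝ), c * Real.exp (-((p + 0) ^ 2 / (8 * τ))) := by
    rw [← Real.norm_eq_abs]
    refine norm_integral_le_of_norm_le
      ((integrable_exp_neg_sq_div hτ 0).const_mul c).integrableOn ?_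
    filter_upwards [ae_restrict_mem measurableSet_Ioi] with p hp
    have hp : 0 < p := hp
    rw [norm_mul, Real.norm_eq_abs, Real.norm_eq_abs]
    calc |k p| * |heatD n τ (z + p)|
        ≤ 1 * (gaussConst n * (Real.sqrt τ)⁻¹ ^ (n + 1) *
          Real.exp (-((z + p) ^ 2 / (8 * τ)))) :=
          mul_le_mul (hk1 p hp) (abs_heatD_le n hτ _) (abs_nonneg _) zero_le_one
      _ ≤ gaussConst n * (Real.sqrt τ)⁻¹ ^ (n + 1) *
          (Real.exp (-(z ^ 2 / (8 * τ))) * Real.exp (-((p + 0) ^ 2 / (8 * τ)))) := by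
          rw [one_mul, ← Real.exp_add]
          have := gaussConst_nonneg n
          gcongr
          rw [add_zero, ← neg_add, ← add_div]
          gcongr
          nlinarith
      _ = _ := by rw [hc]; ring
  refine h1.trans ?_
  rw [integral_const_mul]
  refine (mul_le_mul_of_nonneg_left (integral_Ioi_exp_neg_sq_div_le hτ 0) hc0).trans_eq ?_
  rw [hc, pow_succ]
  field_simp

/-- A weight vanishing linearly at the origin gains a further power of `√τ`. -/
theorem abs_heatSup_one_le {c : ℝ} (hk : ∀ p > 0, |k p| ≤ c * p) {τ : ℝ} (hτ : 0 < τ)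
    {z : ℝ} (hz : 0 ≤ z) :
    |heatSup k 1 τ z| ≤ 4 * c * gaussConst 1 * Real.exp (-(z ^ 2 / (8 * τ))) := by
  have hs : 0 < Real.sqrt τ := Real.sqrt_pos.2 hτ
  have hderiv : ∀ x ∈ Ici (0 : ℝ), HasDerivAt (fun p : ℝ => -(4 * τ) * Real.exp (-(p ^ 2 / (8 * τ))))
      (x * Real.exp (-(x ^ 2 / (8 * τ)))) x := by
    intro x _
    have h1 : HasDerivAt (fun p : ℝ => -(p ^ 2 / (8 * τ))) (-(2 * x / (8 * τ))) x := by
      simpa using ((hasDerivAt_pow 2 x).div_const (8 * τ)).fun_neg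
    refine ((h1.exp).const_mul (-(4 * τ))).congr_deriv ?_
    field_simp
    ring
  have hlim : Tendsto (fun p : ℝ => -(4 * τ) * Real.exp (-(p ^ 2 / (8 * τ)))) atTop (𝓝 0) := by
    rw [← mul_zero (-(4 * τ))]
    refine Tendsto.const_mul _ (Real.tendsto_exp_neg_atTop_nhds_zero.comp ?_)
    exact (tendsto_pow_atTop two_ne_zero).atTop_div_const (by positivity)
  have hpos : ∀ x ∈ Ioi (0 : ℝ), 0 ≤ x * Real.exp (-(x ^ 2 / (8 * τ))) := fun x hx =>
    mul_nonneg (le_of_lt hx) (Real.exp_pos _).le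
  have hint := integrableOn_Ioi_deriv_of_nonneg' hderiv hpos hlim
  have hval := integral_Ioi_of_hasDerivAt_of_nonneg' hderiv hpos hlim
  set d := c * gaussConst 1 * (Real.sqrt τ)⁻¹ ^ 2 * Real.exp (-(z ^ 2 / (8 * τ))) with hd
  have h1 : |heatSup k 1 τ z| ≤ ∫ p in Ioi (0 : ℝ), d * (p * Real.exp (-(p ^ 2 / (8 * τ)))) := by
    rw [← Real.norm_eq_abs]
    refine norm_integral_le_of_norm_le (hint.const_mul d) ?_
    filter_upwards [ae_restrict_mem measurableSet_Ioi] with p hp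
    have hp : 0 < p := hp
    rw [norm_mul, Real.norm_eq_abs, Real.norm_eq_abs]
    calc |k p| * |heatD 1 τ (z + p)|
        ≤ (c * p) * (gaussConst 1 * (Real.sqrt τ)⁻¹ ^ 2 *
          Real.exp (-((z + p) ^ 2 / (8 * τ)))) :=
          mul_le_mul (hk p hp) (abs_heatD_le 1 hτ _) (abs_nonneg _) ((abs_nonneg _).trans (hk p hp))
      _ ≤ (c * p) * (gaussConst 1 * (Real.sqrt τ)⁻¹ ^ 2 *
          (Real.exp (-(z ^ 2 / (8 * τ))) * Real.exp (-(p ^ 2 / (8 * τ))))) := by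
          rw [← Real.exp_add]
          have := gaussConst_nonneg 1
          have := (abs_nonneg _).trans (hk p hp)
          gcongr
          rw [← neg_add, ← add_div]
          gcongr
          nlinarith
      _ = _ := by rw [hd]; ring
  refine h1.trans_eq ?_
  rw [integral_const_mul, hval, hd, inv_pow, Real.sq_sqrt hτ.le]
  simp
  field_simp

end Superposition

/-! ### From jets to heat solutions with a bounded mass -/

/-- The mass on the half-line is bounded uniformly in time. -/
def BddMass (f : ℝ → ℝ → ℝ) : Prop :=
  ∃ M : ℝ, ∀ τ > 0, IntegrableOn (f τ) (Ioi 0) ∧ ∫ z in Ioi (0 : ℝ), |f τ z| ≤ M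

theorem BddMass.add {f g : ℝ → ℝ → ℝ} (hf : BddMass f) (hg : BddMass g) :
    BddMass fun τ z => f τ z + g τ z := by
  obtain ⟨M, hM⟩ := hf
  obtain ⟨N, hN⟩ := hg
  refine ⟨M + N, fun τ hτ => ⟨(hM τ hτ).1.add (hN τ hτ).1, ?_⟩⟩
  refine le_trans ?_ (add_le_add (hM τ hτ).2 (hN τ hτ).2)
  rw [← integral_add (hM τ hτ).1.abs (hN τ hτ).1.abs]
  exact integral_mono ((hM τ hτ).1.add (hN τ hτ).1).abs
    ((hM τ hτ).1.abs.add (hN τ hτ).1.abs) fun z => abs_add_le _ _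

theorem BddMass.const_mul {f : ℝ → ℝ → ℝ} (hf : BddMass f) (c : ℝ) :
    BddMass fun τ z => c * f τ z := by
  obtain ⟨M, hM⟩ := hf
  refine ⟨|c| * M, fun τ hτ => ⟨(hM τ hτ).1.const_mul c, ?_⟩⟩
  simp only [abs_mul]
  rw [integral_const_mul]
  exact mul_le_mul_of_nonneg_left (hM τ hτ).2 (abs_nonneg c)

theorem bddMass_of_le {f : ℝ → ℝ → ℝ} (C y : ℝ) (hf : ∀ τ > 0, Continuous (f τ))
    (h : ∀ τ > 0, ∀ z > 0, |f τ z| ≤ C * (Real.sqrt τ)⁻¹ * Real.exp (-((z + y) ^ 2 / (8 * τ)))) :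
    BddMass f := by
  have key : ∀ τ > 0, IntegrableOn (f τ) (Ioi 0) := fun τ hτ => by
    refine Integrable.mono' ((integrable_exp_neg_sq_div hτ y).const_mul
      (C * (Real.sqrt τ)⁻¹)).integrableOn (hf τ hτ).aestronglyMeasurable ?_
    filter_upwards [ae_restrict_mem measurableSet_Ioi] with z hz using h τ hτ z hz
  refine ⟨C * Real.sqrt (8 * Real.pi), fun τ hτ => ⟨key τ hτ, ?_⟩⟩
  have hs : 0 < Real.sqrt τ := Real.sqrt_pos.2 hτ
  have hC : 0 ≤ C * (Real.sqrt τ)⁻¹ := by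
    have := (abs_nonneg _).trans (h τ hτ 1 one_pos)
    exact nonneg_of_mul_nonneg_left this (Real.exp_pos _)
  calc ∫ z in Ioi (0 : ℝ), |f τ z|
      ≤ ∫ z in Ioi (0 : ℝ), C * (Real.sqrt τ)⁻¹ * Real.exp (-((z + y) ^ 2 / (8 * τ))) :=
        setIntegral_mono_on (key τ hτ).abs
          ((integrable_exp_neg_sq_div hτ y).const_mul _).integrableOn measurableSet_Ioi (h τ hτ)
    _ ≤ C * (Real.sqrt τ)⁻¹ * (Real.sqrt (8 * Real.pi) * Real.sqrt τ) := by
        rw [integral_const_mul]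
        exact mul_le_mul_of_nonneg_left (integral_Ioi_exp_neg_sq_div_le hτ y) hC
    _ = _ := by field_simp

theorem bddMass_heatD (y : ℝ) : BddMass fun τ z => heatD 0 τ (z + y) := by
  refine bddMass_of_le (gaussConst 0) y
    (fun τ _ => (continuous_heatD 0 τ).comp (by fun_prop)) fun τ hτ z _ => ?_
  simpa using abs_heatD_le 0 hτ (z + y)

theorem bddMass_heatSup {k : ℝ → ℝ} (hk : Measurable k) (hk1 : ∀ p > 0, |k p| ≤ 1) :
    BddMass (heatSup k 1) := by
  refine bddMass_of_le (gaussConst 1 * Real.sqrt (8 * Real.pi)) 0 (fun τ hτ => ?_)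
    fun τ hτ z hz => ?_
  · exact continuous_iff_continuousAt.2 fun z =>
      ((heatJet_heatSup hk hk1).space 1 τ hτ z).continuousAt
  · simpa using abs_heatSup_le hk1 1 hτ hz.le

/-- Time is rescaled by the viscosity, and the zeroth-order term is absorbed by an exponential. -/
theorem HeatJet.isL1HeatSolution {D : ℕ → ℝ → ℝ → ℝ} (hD : HeatJet D) (hL : BddMass (D 0))
    {ν : ℝ} (hν : 0 < ν) (α : ℤ) :
    IsL1HeatSolution ν α fun t z => Real.exp (-((α : ℝ) ^ 2 * ν * t)) * D 0 (ν * t) z := by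
  have hc : ∀ n, ContinuousOn (fun p : ℝ × ℝ => D n (ν * p.1) p.2) (Ioi 0 ×ˢ univ) := fun n =>
    (hD.cont n).comp (f := fun p : ℝ × ℝ => (ν * p.1, p.2)) (by fun_prop)
      fun p hp => ⟨mul_pos hν hp.1, mem_univ _⟩
  have ht : ∀ t > 0, ∀ z, HasDerivAt
      (fun s => Real.exp (-((α : ℝ) ^ 2 * ν * s)) * D 0 (ν * s) z)
      (Real.exp (-((α : ℝ) ^ 2 * ν * t)) *
        (ν * (D 2 (ν * t) z - (α : ℝ) ^ 2 * D 0 (ν * t) z))) t := by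
    intro t ht z
    have h1 : HasDerivAt (fun s : ℝ => -((α : ℝ) ^ 2 * ν * s)) (-((α : ℝ) ^ 2 * ν)) t := by
      simpa using ((hasDerivAt_id t).const_mul ((α : ℝ) ^ 2 * ν)).fun_neg
    have h2 : HasDerivAt (fun s : ℝ => ν * s) ν t := by
      simpa using (hasDerivAt_id t).const_mul ν
    have h3 : HasDerivAt (fun s => D 0 (ν * s) z) (D 2 (ν * t) z * ν) t :=
      (hD.time 0 (ν * t) (mul_pos hν ht) z).comp t h2
    refine (h1.exp.fun_mul h3).congr_deriv ?_
    ring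
  refine ⟨?_, fun t h z _ => (ht t h z).differentiableAt, ?_, ?_, ?_, ?_⟩
  · exact ContinuousOn.mul (by fun_prop) ((hc 0).mono (prod_mono_right (subset_univ _)))
  · refine ContinuousOn.congr (f := fun p : ℝ × ℝ => Real.exp (-((α : ℝ) ^ 2 * ν * p.1)) *
        (ν * (D 2 (ν * p.1) p.2 - (α : ℝ) ^ 2 * D 0 (ν * p.1) p.2))) ?_
        fun p hp => (ht p.1 hp.1 p.2).deriv
    have h0 := (hc 0).mono (prod_mono_right (subset_univ (Ioi 0)))
    have h2 := (hc 2).mono (prod_mono_right (subset_univ (Ioi 0)))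
    exact ContinuousOn.mul (by fun_prop)
      (continuousOn_const.mul (h2.sub (continuousOn_const.mul h0)))
  · intro t h
    have := contDiff_infty.1 (contDiff_const (c := Real.exp (-((α : ℝ) ^ 2 * ν * t))).mul
      (hD.contDiff (mul_pos hν h))) 2
    exact this.contDiffOn
  · intro t h z _
    rw [(ht t h z).deriv,
      (hD.const_mul (Real.exp (-((α : ℝ) ^ 2 * ν * t)))).iteratedDeriv_eq (mul_pos hν h) 2]
    ring
  · obtain ⟨M, hM⟩ := hL
    refine fun T _ => ⟨M, fun t h _ => ⟨(hM _ (mul_pos hν h)).1.const_mul _, ?_⟩⟩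
    refine le_trans ?_ (hM _ (mul_pos hν h)).2
    refine integral_mono ((hM _ (mul_pos hν h)).1.const_mul _).abs (hM _ (mul_pos hν h)).1.abs
      fun z => ?_
    simp only [abs_mul, Real.abs_exp]
    refine mul_le_of_le_one_left (abs_nonneg _) (Real.exp_le_one_iff.2 ?_)
    have : 0 ≤ (α : ℝ) ^ 2 * ν * t := by positivity
    linarith

/-! ### Initial data -/

/-- The heat kernel is an approximate identity; the datum needs to be continuous only at the
point of evaluation, which allows discontinuous extensions from the half-line. -/
theorem tendsto_integral_heatD {f : ℝ → ℝ} (hf : Measurable f) {C : ℝ} (hC : ∀ x, |f x| ≤ C)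
    {y : ℝ} (hy : ContinuousAt f y) :
    Tendsto (fun τ => ∫ x, heatD 0 τ (x - y) * f x) (𝓝[>] 0) (𝓝 (f y)) := by
  have hsub : ∀ τ > 0, ∫ x, heatD 0 τ (x - y) * f x =
      ∫ u, gaussDeriv 0 u * f (y + Real.sqrt τ * u) := by
    intro τ hτ
    have hs : 0 < Real.sqrt τ := Real.sqrt_pos.2 hτ
    have h1 := integral_sub_right_eq_self (μ := volume)
      (fun x : ℝ => heatD 0 τ x * f (x + y)) y
    have h2 := Measure.integral_comp_mul_right
      (fun u => gaussDeriv 0 u * f (y + Real.sqrt τ * u)) (Real.sqrt τ)⁻¹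
    simp only [sub_add_cancel] at h1
    rw [inv_inv, abs_of_pos hs, smul_eq_mul] at h2
    refine h1.trans (Eq.trans ?_ (inv_mul_cancel_left₀ hs.ne' _))
    rw [← h2, ← integral_const_mul]
    congr 1
    funext x
    have : Real.sqrt τ * (x * (Real.sqrt τ)⁻¹) = x := by field_simp
    rw [this, heatD, zero_add, pow_one, add_comm x y]
    ring
  have hlim : Tendsto (fun τ => ∫ u, gaussDeriv 0 u * f (y + Real.sqrt τ * u)) (𝓝[>] 0)
      (𝓝 (∫ u, gaussDeriv 0 u * f y)) := by
    have hint : Integrable (gaussDeriv 0) := by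
      simpa [heatD] using integrable_heatD 0 one_pos 0
    refine tendsto_integral_filter_of_dominated_convergence (fun u => |gaussDeriv 0 u| * C)
      (Eventually.of_forall fun τ => ?_) (Eventually.of_forall fun τ => ?_)
      (hint.abs.mul_const C) (Eventually.of_forall fun u => ?_)
    · exact ((continuous_gaussDeriv 0).measurable.mul
        (hf.comp (by fun_prop))).aestronglyMeasurable
    · refine Eventually.of_forall fun u => ?_
      rw [norm_mul, Real.norm_eq_abs, Real.norm_eq_abs]
      exact mul_le_mul_of_nonneg_left (hC _) (abs_nonneg _)
    · refine Tendsto.const_mul _ (hy.tendsto.comp ?_)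
      have : Continuous fun τ => y + Real.sqrt τ * u := by fun_prop
      have h := this.tendsto 0
      simp only [Real.sqrt_zero, zero_mul, add_zero] at h
      exact h.mono_left nhdsWithin_le_nhds
  rw [integral_mul_const, integral_gaussDeriv_zero, one_mul] at hlim
  refine hlim.congr' ?_
  filter_upwards [self_mem_nhdsWithin] with τ hτ using (hsub τ hτ).symm

theorem integrable_heatD_mul {τ : ℝ} (hτ : 0 < τ) (y : ℝ) {f : ℝ → ℝ} (hf : Measurable f) {C : ℝ}
    (hC : ∀ x, |f x| ≤ C) : Integrable fun x => heatD 0 τ (x + y) * f x :=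
  (integrable_heatD 0 hτ y).mul_bdd hf.aestronglyMeasurable (Eventually.of_forall hC)

/-- The jet of the Neumann heat kernel of the half-line with source at `y`. -/
noncomputable def neumannJet (y : ℝ) (n : ℕ) (τ z : ℝ) : ℝ :=
  heatD n τ (z + -y) + heatD n τ (z + y)

theorem heatJet_neumannJet (y : ℝ) : HeatJet (neumannJet y) :=
  (heatJet_heatD (-y)).add (heatJet_heatD y)

theorem bddMass_neumannJet (y : ℝ) : BddMass (neumannJet y 0) :=
  (bddMass_heatD (-y)).add (bddMass_heatD y)

theorem integrableOn_neumannJet_mul {τ : ℝ} (hτ : 0 < τ) (y : ℝ) (φ : ℝ →ᵇ ℝ) :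
    IntegrableOn (fun z => neumannJet y 0 τ z * φ z) (Ioi 0) := by
  have h : ∀ y, Integrable fun z => heatD 0 τ (z + y) * φ z := fun y =>
    integrable_heatD_mul hτ y φ.continuous.measurable φ.norm_coe_le_norm
  exact ((h (-y)).add (h y)).integrableOn.congr
    (Eventually.of_forall fun z => by simp [neumannJet, add_mul])

/-- The Neumann evolution is the evolution on the line of the even extension. -/
theorem tendsto_integral_neumannJet {y : ℝ} (hy : 0 ≤ y) (φ : ℝ →ᵇ ℝ) :
    Tendsto (fun τ => ∫ z in Ioi (0 : ℝ), neumannJet y 0 τ z * φ z) (𝓝[>] 0) (𝓝 (φ y)) := by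
  have hcont : Continuous fun x => φ |x| := φ.continuous.comp continuous_abs
  have h := tendsto_integral_heatD (y := y) hcont.measurable
    (fun x => φ.norm_coe_le_norm |x|) hcont.continuousAt
  rw [abs_of_nonneg hy] at h
  refine h.congr' ?_
  filter_upwards [self_mem_nhdsWithin] with τ hτ
  have hi := integrable_heatD_mul hτ (-y) hcont.measurable (fun x => φ.norm_coe_le_norm |x|)
  have hi' := integrable_heatD_mul hτ y hcont.measurable (fun x => φ.norm_coe_le_norm |x|)
  simp only [sub_eq_add_neg]
  rw [← intervalIntegral.integral_Iic_add_Ioi (b := (0 : ℝ)) hi.integrableOn hi.integrableOn]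
  have h2 := integral_comp_neg_Iic (0 : ℝ) fun x => heatD 0 τ (-x + -y) * φ |-x|
  simp only [neg_neg, neg_zero] at h2
  rw [h2]
  have e : ∀ x, heatD 0 τ (-x + -y) * φ |-x| = heatD 0 τ (x + y) * φ |x| := fun x => by
    rw [← neg_add, heatD_zero_neg, abs_neg]
  simp only [e]
  rw [← integral_add hi'.integrableOn hi.integrableOn]
  refine setIntegral_congr_fun measurableSet_Ioi fun x hx => ?_
  simp only [neumannJet]
  rw [abs_of_pos hx]
  ring

theorem tendsto_integral_heatD_image {y : ℝ} (hy : 0 ≤ y) (φ : ℝ →ᵇ ℝ) (hφ : y = 0 → φ 0 = 0) :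
    Tendsto (fun τ => ∫ z in Ioi (0 : ℝ), heatD 0 τ (z + y) * φ z) (𝓝[>] 0) (𝓝 0) := by
  set f : ℝ → ℝ := (Ioi (0 : ℝ)).indicator φ with hf
  have hle : ∀ x, |f x| ≤ |φ x| := fun x => norm_indicator_le_norm_self (s := Ioi 0) φ x
  have hf0 : f (-y) = 0 := indicator_of_notMem (by simpa using hy) _
  have hc : ContinuousAt f (-y) := by
    rcases hy.eq_or_lt with rfl | hy
    · rw [ContinuousAt, hf0]
      refine squeeze_zero_norm hle ?_
      have := (φ.continuous.abs).tendsto (-0)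
      simpa [hφ rfl] using this
    · refine (continuousAt_const (y := (0 : ℝ))).congr ?_
      filter_upwards [Iio_mem_nhds (show -y < 0 by linarith)] with x hx
      exact (indicator_of_notMem (by simpa using le_of_lt hx) _).symm
  have h := tendsto_integral_heatD (y := -y)
    (φ.continuous.measurable.indicator measurableSet_Ioi)
    (fun x => (hle x).trans (φ.norm_coe_le_norm x)) hc
  rw [← hf, hf0] at h
  refine h.congr fun τ => ?_
  rw [← integral_indicator measurableSet_Ioi]
  congr 1
  funext x
  by_cases hx : x ∈ Ioi (0 : ℝ)
  · simp [hf, indicator_of_mem hx]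
  · simp [hf, indicator_of_notMem hx]

theorem tendsto_damped_mul {g : ℝ → ℝ} {ν l : ℝ} (hν : 0 < ν) (α : ℤ)
    (h : Tendsto g (𝓝[>] 0) (𝓝 l)) :
    Tendsto (fun t => Real.exp (-((α : ℝ) ^ 2 * ν * t)) * g (ν * t)) (𝓝[>] 0) (𝓝 l) := by
  have h1 : Tendsto (fun t : ℝ => ν * t) (𝓝[>] 0) (𝓝[>] 0) := by
    refine tendsto_nhdsWithin_iff.2 ⟨?_, ?_⟩
    · have : Continuous fun t : ℝ => ν * t := by fun_prop
      simpa using (this.tendsto 0).mono_left nhdsWithin_le_nhds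
    · filter_upwards [self_mem_nhdsWithin] with t ht using mul_pos hν ht
  have h2 : Tendsto (fun t : ℝ => Real.exp (-((α : ℝ) ^ 2 * ν * t))) (𝓝[>] 0) (𝓝 1) := by
    have : Continuous fun t : ℝ => Real.exp (-((α : ℝ) ^ 2 * ν * t)) := by fun_prop
    simpa using (this.tendsto 0).mono_left nhdsWithin_le_nhds
  simpa using h2.mul (h.comp h1)

theorem stokesH_eq {ν t : ℝ} (hν : 0 < ν) (α : ℤ) (ht : 0 < t) (z y : ℝ) :
    stokesH ν α t z y = Real.exp (-((α : ℝ) ^ 2 * ν * t)) * neumannJet y 0 (ν * t) z := by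
  rw [neumannJet, heatD_zero_eq (mul_pos hν ht), heatD_zero_eq (mul_pos hν ht), stokesH, sq_abs,
    sq_abs]
  have e1 : (z + -y) ^ 2 = (y - z) ^ 2 := by ring
  have e2 : (z + y) ^ 2 = (y + z) ^ 2 := by ring
  rw [e1, e2]
  simp only [mul_assoc]
  ring

theorem IsL1HeatSolution.congr {ν : ℝ} {α : ℤ} {f g : ℝ → ℝ → ℝ} (hf : IsL1HeatSolution ν α f)
    (h : ∀ t > 0, g t = f t) : IsL1HeatSolution ν α g := by
  have hd : ∀ t > 0, ∀ z, (fun s => g s z) =ᶠ[𝓝 t] fun s => f s z := fun t ht z => by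
    filter_upwards [Ioi_mem_nhds ht] with s hs
    rw [h s hs]
  refine ⟨hf.continuousOn.congr fun p hp => by rw [h p.1 hp.1], fun t ht z hz =>
    (hd t ht z).symm.differentiableAt_iff.1 (hf.differentiableAt_time t ht z hz), ?_, ?_, ?_, ?_⟩
  · exact hf.continuousOn_time_deriv.congr fun p hp => (hd p.1 hp.1 p.2).deriv_eq
  · intro t ht
    rw [h t ht]
    exact hf.contDiffOn_space t ht
  · intro t ht z hz
    rw [(hd t ht z).deriv_eq, h t ht]
    exact hf.equation t ht z hz
  · intro T hT
    obtain ⟨M, hM⟩ := hf.l1_bounded T hT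
    refine ⟨M, fun t ht htT => ?_⟩
    rw [h t ht]
    exact hM t ht htT

theorem isNeumannGreen_stokesH {ν : ℝ} (hν : 0 < ν) (α : ℤ) :
    IsNeumannGreen ν α (stokesH ν α) where
  solution y _ := ((heatJet_neumannJet y).isL1HeatSolution (bddMass_neumannJet y) hν α).congr
    fun t ht => funext fun z => stokesH_eq hν α ht z y
  boundary y _ t ht := by
    have h := ((heatJet_neumannJet y).space 0 (ν * t) (mul_pos hν ht) 0).const_mul
      (Real.exp (-((α : ℝ) ^ 2 * ν * t)))
    have e : neumannJet y 1 (ν * t) 0 = 0 := by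
      simp [neumannJet, heatD_one_neg]
    rw [zero_add, e, mul_zero] at h
    refine (h.congr_of_eventuallyEq (Eventually.of_forall fun z => ?_)).hasDerivWithinAt
    exact stokesH_eq hν α ht z y
  initial y hy φ := by
    refine (tendsto_damped_mul hν α (tendsto_integral_neumannJet hy φ)).congr' ?_
    filter_upwards [self_mem_nhdsWithin] with t ht
    rw [← integral_const_mul]
    congr 1
    funext z
    rw [stokesH_eq hν α ht]
    ring

/-! ### The explicit Green function -/

/-- The weight `k(p) = ∫ c e^{-a(y-x)} e^{-(a+c)w}` over the segment `x + w = p`, `0 ≤ x ≤ y`,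
`w ≥ 0`, in closed form. With `a = |α|` and `c = 1/ν`, its superposition of heat kernels turns the
Dirichlet kernel into the solution of the nonlocal boundary condition. -/
noncomputable def stokesWeight (a c y p : ℝ) : ℝ :=
  c / (2 * a + c) * (Real.exp (-(a * y + (a + c) * p)) * (Real.exp ((2 * a + c) * min y p) - 1))

section Weight

variable {a c y : ℝ}

theorem continuous_stokesWeight : Continuous (stokesWeight a c y) := by
  unfold stokesWeight
  fun_prop

theorem exp_mul_min_le (ha : 0 ≤ a) (hc : 0 < c) (y p : ℝ) :
    Real.exp (-(a * y + (a + c) * p)) * Real.exp ((2 * a + c) * min y p) ≤ 1 := by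
  rw [← Real.exp_add, Real.exp_le_one_iff]
  have h1 := mul_le_mul_of_nonneg_left (min_le_left y p) ha
  have h2 := mul_le_mul_of_nonneg_left (min_le_right y p) (show 0 ≤ a + c by positivity)
  linarith

theorem stokesWeight_nonneg (ha : 0 ≤ a) (hc : 0 < c) (hy : 0 ≤ y) {p : ℝ} (hp : 0 < p) :
    0 ≤ stokesWeight a c y p := by
  have h : 0 ≤ (2 * a + c) * min y p := mul_nonneg (by positivity) (le_min hy hp.le)
  have h2 := Real.one_le_exp h
  exact mul_nonneg (by positivity) (mul_nonneg (Real.exp_pos _).le (by linarith))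

theorem abs_stokesWeight_le_one (ha : 0 ≤ a) (hc : 0 < c) (hy : 0 ≤ y) {p : ℝ} (hp : 0 < p) :
    |stokesWeight a c y p| ≤ 1 := by
  rw [abs_of_nonneg (stokesWeight_nonneg ha hc hy hp)]
  have h1 := exp_mul_min_le ha hc y p
  have h2 : c / (2 * a + c) ≤ 1 := (div_le_one (by positivity)).2 (by linarith)
  have h3 : Real.exp (-(a * y + (a + c) * p)) * (Real.exp ((2 * a + c) * min y p) - 1) ≤ 1 := by
    have := Real.exp_pos (-(a * y + (a + c) * p))
    linarith
  have h4 : 0 ≤ c / (2 * a + c) := by positivity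
  calc _ ≤ c / (2 * a + c) * 1 := mul_le_mul_of_nonneg_left h3 h4
    _ ≤ 1 := by linarith

theorem abs_stokesWeight_le_mul (ha : 0 ≤ a) (hc : 0 < c) (hy : 0 ≤ y) {p : ℝ} (hp : 0 < p) :
    |stokesWeight a c y p| ≤ c * p := by
  rw [abs_of_nonneg (stokesWeight_nonneg ha hc hy hp)]
  have h1 := exp_mul_min_le ha hc y p
  set m := min y p with hm
  have hm0 : 0 ≤ m := le_min hy hp.le
  have hb : 0 < 2 * a + c := by positivity
  -- `e^x - 1 ≤ x e^x`
  have h2 : Real.exp ((2 * a + c) * m) - 1 ≤ (2 * a + c) * m * Real.exp ((2 * a + c) * m) := by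
    have h := Real.add_one_le_exp (-((2 * a + c) * m))
    have h' := mul_le_mul_of_nonneg_right h (Real.exp_pos ((2 * a + c) * m)).le
    rw [← Real.exp_add, neg_add_cancel, Real.exp_zero] at h'
    linarith
  calc stokesWeight a c y p
      ≤ c / (2 * a + c) * (Real.exp (-(a * y + (a + c) * p)) *
        ((2 * a + c) * m * Real.exp ((2 * a + c) * m))) := by
        unfold stokesWeight
        gcongr
    _ = c * m * (Real.exp (-(a * y + (a + c) * p)) * Real.exp ((2 * a + c) * m)) := by
        field_simp
    _ ≤ c * m * 1 := by gcongr
    _ ≤ c * p := by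
        rw [mul_one]
        exact mul_le_mul_of_nonneg_left (min_le_right y p) hc.le

theorem hasDerivAt_exp_mul (b x : ℝ) :
    HasDerivAt (fun x : ℝ => Real.exp (b * x)) (b * Real.exp (b * x)) x := by
  have h : HasDerivAt (fun x : ℝ => b * x) b x := by
    simpa using (hasDerivAt_id x).const_mul b
  exact h.exp.congr_deriv (mul_comm _ _)

theorem stokesWeight_of_le {p : ℝ} (hp : p ≤ y) : stokesWeight a c y p =
    c / (2 * a + c) * Real.exp (-(a * y)) * (Real.exp (a * p) - Real.exp (-(a + c) * p)) := by
  have e1 : Real.exp (-(a * y + (a + c) * p)) * Real.exp ((2 * a + c) * p) =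
      Real.exp (-(a * y)) * Real.exp (a * p) := by
    rw [← Real.exp_add, ← Real.exp_add]
    ring_nf
  have e2 : Real.exp (-(a * y + (a + c) * p)) =
      Real.exp (-(a * y)) * Real.exp (-(a + c) * p) := by
    rw [← Real.exp_add]
    ring_nf
  rw [stokesWeight, min_eq_right hp, mul_sub, mul_one, e1, e2]
  ring

theorem stokesWeight_of_ge {p : ℝ} (hp : y ≤ p) : stokesWeight a c y p =
    c / (2 * a + c) * Real.exp (-(a * y)) * (Real.exp ((2 * a + c) * y) - 1) *
      Real.exp (-(a + c) * p) := by
  have e : -(a * y + (a + c) * p) = -(a * y) + -(a + c) * p := by ring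
  rw [stokesWeight, min_eq_left hp, e, Real.exp_add]
  ring

theorem measurable_exp_neg_mul : Measurable fun z : ℝ => Real.exp (-(a * z)) := by fun_prop

theorem abs_exp_neg_mul_le_one (ha : 0 ≤ a) : ∀ z > 0, |Real.exp (-(a * z))| ≤ 1 := fun z hz => by
  rw [Real.abs_exp, Real.exp_le_one_iff]
  have : 0 ≤ a * z := by positivity
  linarith

theorem tendsto_heatD_atTop (n : ℕ) {τ : ℝ} (hτ : 0 < τ) (x : ℝ) :
    Tendsto (fun z => heatD n τ (x + z)) atTop (𝓝 0) := by
  refine squeeze_zero_norm (fun z => abs_heatD_le n hτ (x + z)) ?_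
  rw [← mul_zero (gaussConst n * (Real.sqrt τ)⁻¹ ^ (n + 1))]
  refine Tendsto.const_mul _ (Real.tendsto_exp_neg_atTop_nhds_zero.comp ?_)
  exact ((tendsto_pow_atTop two_ne_zero).comp
    (tendsto_atTop_add_const_left _ x tendsto_id)).atTop_div_const (by positivity)

/-- Integration by parts in the Laplace transform of the heat kernel. -/
theorem heatSup_exp_succ (ha : 0 ≤ a) (n : ℕ) {τ : ℝ} (hτ : 0 < τ) (x : ℝ) :
    heatSup (fun z => Real.exp (-(a * z))) (n + 1) τ x =
      a * heatSup (fun z => Real.exp (-(a * z))) n τ x - heatD n τ x := by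
  have hm := measurable_exp_neg_mul (a := a)
  have h1 := abs_exp_neg_mul_le_one ha
  have i0 := integrableOn_heatSup hm h1 n hτ x
  have i1 := integrableOn_heatSup hm h1 (n + 1) hτ x
  have hd : ∀ z ∈ Ici (0 : ℝ), HasDerivAt (fun z => Real.exp (-(a * z)) * heatD n τ (x + z))
      (Real.exp (-(a * z)) * heatD (n + 1) τ (x + z) -
        a * (Real.exp (-(a * z)) * heatD n τ (x + z))) z := fun z _ => by
    have h2 := hasDerivAt_exp_mul (-a) z
    simp only [neg_mul] at h2
    refine (h2.fun_mul ((hasDerivAt_heatD_space n τ (x + z)).comp_const_add x z)).congr_deriv ?_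
    ring
  have hl : Tendsto (fun z => Real.exp (-(a * z)) * heatD n τ (x + z)) atTop (𝓝 0) := by
    refine squeeze_zero_norm' ?_ (tendsto_zero_iff_abs_tendsto_zero _ |>.1
      (tendsto_heatD_atTop n hτ x))
    filter_upwards [eventually_gt_atTop 0] with z hz
    rw [norm_mul, Real.norm_eq_abs, Real.norm_eq_abs]
    exact mul_le_of_le_one_left (abs_nonneg _) (h1 z hz)
  have h := integral_Ioi_of_hasDerivAt_of_tendsto' hd (i1.sub (i0.const_mul a)) hl
  rw [integral_sub i1 (i0.const_mul a), integral_const_mul] at h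
  simp only [mul_zero, neg_zero, Real.exp_zero, one_mul, add_zero, zero_sub] at h
  simp only [heatSup]
  linarith

/-- The weight is chosen such that this integrand is an exact derivative on each side of
`p = y`. Here `E₀` stands for the Laplace transform `∫_0^∞ e^{-az} h₀(p + z) dz` of the even
function `h₀`, `E₁` and `E₂` for its derivatives, and `h₁` for the derivative of `h₀`. -/
theorem integral_stokesWeight_mul_of_hasDerivAt (ha : 0 ≤ a) (hc : 0 < c) (hy : 0 ≤ y)
    {E₀ E₁ E₂ h₀ h₁ : ℝ → ℝ} (d₀ : ∀ p, HasDerivAt E₀ (E₁ p) p)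
    (d₁ : ∀ p, HasDerivAt E₁ (E₂ p) p) (rec₀ : ∀ p, E₁ p = a * E₀ p - h₀ p)
    (rec₁ : ∀ p, E₂ p = a * E₁ p - h₁ p) (heven : ∀ p, h₀ (-p) = h₀ p) (hh₁ : Continuous h₁)
    (hlim : Tendsto E₁ atTop (𝓝 0)) (hint : IntegrableOn (fun p => h₁ p + c * E₁ p) (Ioi 0)) :
    ∫ p in Ioi (0 : ℝ), stokesWeight a c y p * (h₁ p + c * E₁ p) =
      c / 2 * (E₀ y - E₀ (-y)) := by
  have hb : 2 * a + c ≠ 0 := by positivity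
  have hintf : IntegrableOn (fun p => stokesWeight a c y p * (h₁ p + c * E₁ p)) (Ioi 0) := by
    refine hint.bdd_mul (c := 1) continuous_stokesWeight.aestronglyMeasurable ?_
    filter_upwards [ae_restrict_mem measurableSet_Ioi] with p hp
    exact abs_stokesWeight_le_one ha hc hy hp
  set f : ℝ → ℝ := fun p => stokesWeight a c y p * (h₁ p + c * E₁ p) with hf
  have hcf : Continuous f := continuous_stokesWeight.mul (hh₁.add (continuous_const.mul
    (continuous_iff_continuousAt.2 fun p => (d₁ p).continuousAt)))
  -- `A` and `B` are the coefficients of the weight for `p ≤ y` and for `p ≥ y`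
  obtain ⟨A, hA⟩ : ∃ A, A = c / (2 * a + c) * Real.exp (-(a * y)) := ⟨_, rfl⟩
  have hA2 : c / 2 * Real.exp (-(a * y)) = A * (2 * a + c) / 2 := by
    rw [hA]
    field_simp
  obtain ⟨B, hB⟩ : ∃ B, B = A * (Real.exp ((2 * a + c) * y) - 1) := ⟨_, rfl⟩
  have hw₁ : ∀ p ≤ y, stokesWeight a c y p =
      A * (Real.exp (a * p) - Real.exp (-(a + c) * p)) := fun p hp => by
    rw [stokesWeight_of_le hp, hA]
  have hw₂ : ∀ p ≥ y, stokesWeight a c y p = B * Real.exp (-(a + c) * p) := fun p hp => by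
    rw [stokesWeight_of_ge hp, hB, hA]
  have hd₁ : ∀ p ∈ uIcc 0 y, HasDerivAt
      (fun p => -(A * (Real.exp (a * p) - Real.exp (-(a + c) * p)) * E₁ p) +
        c / 2 * Real.exp (-(a * y)) * (Real.exp (a * p) * (E₀ p - E₀ (-p)))) (f p) p := by
    intro p hp
    rw [uIcc_of_le hy] at hp
    have e1 := ((hasDerivAt_exp_mul a p).fun_sub (hasDerivAt_exp_mul (-(a + c)) p)).const_mul A
    have e2 := (e1.fun_mul (d₁ p)).fun_neg
    have e3 : HasDerivAt (fun p => E₀ (-p)) (-E₁ (-p)) p :=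
      ((d₀ (-p)).comp p (hasDerivAt_neg p)).congr_deriv (mul_neg_one _)
    have e4 := ((hasDerivAt_exp_mul a p).fun_mul
      ((d₀ p).fun_sub e3)).const_mul (c / 2 * Real.exp (-(a * y)))
    refine (e2.fun_add e4).congr_deriv ?_
    have r0 := rec₀ (-p)
    rw [heven] at r0
    simp only [hf]
    rw [hw₁ p hp.2, rec₁ p, hA2, r0, show h₀ p = a * E₀ p - E₁ p by linarith [rec₀ p]]
    ring
  have hI₁ := intervalIntegral.integral_eq_sub_of_hasDerivAt hd₁
    (hcf.intervalIntegrable 0 y)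
  have hd₂ : ∀ p ∈ Ici y, HasDerivAt (fun p => -(B * Real.exp (-(a + c) * p) * E₁ p)) (f p) p := by
    intro p hp
    have e1 := (hasDerivAt_exp_mul (-(a + c)) p).const_mul B
    refine (e1.fun_mul (d₁ p)).fun_neg.congr_deriv ?_
    simp only [hf]
    rw [hw₂ p hp, rec₁ p]
    ring
  have hl₂ : Tendsto (fun p => -(B * Real.exp (-(a + c) * p) * E₁ p)) atTop (𝓝 0) := by
    rw [← neg_zero]
    refine Tendsto.neg ?_
    refine squeeze_zero_norm' ?_ (tendsto_zero_iff_abs_tendsto_zero _ |>.1 hlim)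
    filter_upwards [eventually_gt_atTop 0, eventually_ge_atTop y] with z hz hzy
    rw [norm_mul, Real.norm_eq_abs, Real.norm_eq_abs, ← hw₂ z hzy]
    exact mul_le_of_le_one_left (abs_nonneg _) (abs_stokesWeight_le_one ha hc hy hz)
  have hI₂ := integral_Ioi_of_hasDerivAt_of_tendsto' hd₂
    (hintf.mono_set (Ioi_subset_Ioi hy)) hl₂
  have hexp : Real.exp (-(a * y)) * Real.exp (a * y) = 1 := by
    rw [← Real.exp_add, neg_add_cancel, Real.exp_zero]
  rw [← intervalIntegral.integral_interval_add_Ioi hintf (hintf.mono_set (Ioi_subset_Ioi hy)),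
    hI₁, hI₂, ← hw₂ y le_rfl, ← hw₁ y le_rfl]
  simp only [mul_zero, sub_self, neg_zero, zero_mul, Real.exp_zero]
  linear_combination (c / 2 * (E₀ y - E₀ (-y))) * hexp

theorem integral_stokesWeight_mul (ha : 0 ≤ a) (hc : 0 < c) (hy : 0 ≤ y) {τ : ℝ} (hτ : 0 < τ) :
    ∫ p in Ioi (0 : ℝ), stokesWeight a c y p *
      (heatD 1 τ p + c * heatSup (fun z => Real.exp (-(a * z))) 1 τ p) =
    c / 2 * (heatSup (fun z => Real.exp (-(a * z))) 0 τ y -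
      heatSup (fun z => Real.exp (-(a * z))) 0 τ (-y)) := by
  have hm := measurable_exp_neg_mul (a := a)
  have h1 := abs_exp_neg_mul_le_one ha
  have hjet := heatJet_heatSup hm h1
  refine integral_stokesWeight_mul_of_hasDerivAt ha hc hy (hjet.space 0 τ hτ)
    (hjet.space 1 τ hτ) (heatSup_exp_succ ha 0 hτ) (heatSup_exp_succ ha 1 hτ)
    (heatD_zero_neg τ) (continuous_heatD 1 τ) ?_ ?_
  · have hlim : Tendsto (fun z : ℝ => gaussConst 1 * Real.sqrt (8 * Real.pi) *
        (Real.sqrt τ)⁻¹ ^ 1 * Real.exp (-(z ^ 2 / (8 * τ)))) atTop (𝓝 0) := by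
      rw [← mul_zero (gaussConst 1 * Real.sqrt (8 * Real.pi) * (Real.sqrt τ)⁻¹ ^ 1)]
      refine Tendsto.const_mul _ (Real.tendsto_exp_neg_atTop_nhds_zero.comp ?_)
      exact (tendsto_pow_atTop two_ne_zero).atTop_div_const (by positivity)
    refine squeeze_zero_norm' ?_ hlim
    filter_upwards [eventually_ge_atTop 0] with z hz using abs_heatSup_le h1 1 hτ hz
  · have := (integrable_heatD 1 hτ 0).integrableOn (s := Ioi (0 : ℝ))
    simp only [add_zero] at this
    obtain ⟨M, hM⟩ := bddMass_heatSup hm h1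
    exact this.add ((hM τ hτ).1.const_mul c)

/-- Fubini: the Laplace transform in `z` acts on the heat kernel inside the superposition. -/
theorem integral_exp_mul_heatSup (ha : 0 ≤ a) {k : ℝ → ℝ} (hk : Measurable k)
    (hk1 : ∀ p > 0, |k p| ≤ 1) {τ : ℝ} (hτ : 0 < τ) :
    ∫ z in Ioi (0 : ℝ), Real.exp (-(a * z)) * heatSup k 1 τ z =
      ∫ p in Ioi (0 : ℝ), k p * heatSup (fun z => Real.exp (-(a * z))) 1 τ p := by
  have hswap : Integrable (Function.uncurry fun z p : ℝ =>
      Real.exp (-(a * z)) * (k p * heatD 1 τ (z + p)))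
      ((volume.restrict (Ioi 0)).prod (volume.restrict (Ioi 0))) := by
    have hg := (integrable_exp_neg_sq_div hτ 0).integrableOn (s := Ioi (0 : ℝ))
    refine Integrable.mono' ((hg.mul_prod hg).const_mul
      (gaussConst 1 * (Real.sqrt τ)⁻¹ ^ 2)) ?_ ?_
    · refine Measurable.aestronglyMeasurable ?_
      refine Measurable.mul (by fun_prop) ((hk.comp measurable_snd).mul ?_)
      exact (continuous_heatD 1 τ).measurable.comp (by fun_prop)
    · rw [Measure.prod_restrict]
      filter_upwards [ae_restrict_mem (measurableSet_Ioi.prod measurableSet_Ioi)] with q hq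
      have hz : 0 < q.1 := hq.1
      have hp : 0 < q.2 := hq.2
      simp only [Function.uncurry, add_zero, ← Real.exp_add]
      rw [norm_mul, norm_mul, Real.norm_eq_abs, Real.norm_eq_abs, Real.norm_eq_abs]
      calc |Real.exp (-(a * q.1))| * (|k q.2| * |heatD 1 τ (q.1 + q.2)|)
          ≤ 1 * (1 * |heatD 1 τ (q.1 + q.2)|) := by
            gcongr
            · exact abs_exp_neg_mul_le_one ha q.1 hz
            · exact hk1 q.2 hp
        _ ≤ gaussConst 1 * (Real.sqrt τ)⁻¹ ^ 2 *
            Real.exp (-((q.1 + q.2) ^ 2 / (8 * τ))) := by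
            rw [one_mul, one_mul]
            exact abs_heatD_le 1 hτ _
        _ ≤ _ := by
            have := gaussConst_nonneg 1
            gcongr
            rw [← neg_add, ← add_div]
            gcongr
            nlinarith
  simp only [heatSup, ← integral_const_mul]
  rw [integral_integral_swap hswap]
  congr 1
  funext p
  congr 1
  funext z
  rw [add_comm p z]
  ring

end Weight

/-- The jet of the residual kernel, without the factor `e^{-a²τ}`: minus twice the image
source, which turns the Neumann kernel into the Dirichlet kernel, and the superposition producing
the nonlocal boundary condition. -/
noncomputable def residualJet (a c y : ℝ) (n : ℕ) (τ z : ℝ) : ℝ :=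
  -2 * heatD n τ (z + y) + 2 * heatSup (stokesWeight a c y) (n + 1) τ z

section Residual

variable {a c y : ℝ}

theorem heatJet_residualJet (ha : 0 ≤ a) (hc : 0 < c) (hy : 0 ≤ y) :
    HeatJet (residualJet a c y) :=
  ((heatJet_heatD y).const_mul (-2)).add ((heatJet_heatSup continuous_stokesWeight.measurable
    fun _ hp => abs_stokesWeight_le_one ha hc hy hp).shift.const_mul 2)

theorem bddMass_residualJet (ha : 0 ≤ a) (hc : 0 < c) (hy : 0 ≤ y) :
    BddMass (residualJet a c y 0) :=
  ((bddMass_heatD y).const_mul (-2)).add ((bddMass_heatSup continuous_stokesWeight.measurable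
    fun _ hp => abs_stokesWeight_le_one ha hc hy hp).const_mul 2)

/-- The bound is uniform in `a` and `c`, that is, in the wave number and the viscosity, because
the weight is bounded by `1` whatever these parameters are. -/
theorem abs_residualJet_le (ha : 0 ≤ a) (hc : 0 < c) (hy : 0 ≤ y) (n : ℕ) {τ : ℝ} (hτ : 0 < τ)
    {z : ℝ} (hz : 0 ≤ z) : |residualJet a c y n τ z| ≤
      (2 * gaussConst n + 2 * (gaussConst (n + 1) * Real.sqrt (8 * Real.pi))) *
        ((Real.sqrt τ)⁻¹ ^ (n + 1) * Real.exp (-(z ^ 2 / (8 * τ)))) := by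
  have h1 := abs_heatD_le n hτ (z + y)
  have h2 := abs_heatSup_le
    (fun _ hp => abs_stokesWeight_le_one ha hc hy hp) (n + 1) hτ hz
  have h3 : Real.exp (-((z + y) ^ 2 / (8 * τ))) ≤ Real.exp (-(z ^ 2 / (8 * τ))) := by
    gcongr
    linarith
  have h4 : |heatD n τ (z + y)| ≤ gaussConst n * (Real.sqrt τ)⁻¹ ^ (n + 1) *
      Real.exp (-(z ^ 2 / (8 * τ))) := by
    refine h1.trans ?_
    have := gaussConst_nonneg n
    gcongr
  refine (abs_add_le _ _).trans ?_
  rw [abs_mul, abs_mul, abs_neg, abs_two]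
  linarith

theorem tendsto_integral_residualJet (ha : 0 ≤ a) (hc : 0 < c) (hy : 0 ≤ y) (φ : ℝ →ᵇ ℝ)
    (hφ : y = 0 → φ 0 = 0) :
    Tendsto (fun τ => ∫ z in Ioi (0 : ℝ), residualJet a c y 0 τ z * φ z) (𝓝[>] 0) (𝓝 0) := by
  have hk1 : ∀ p > 0, |stokesWeight a c y p| ≤ 1 :=
    fun _ hp => abs_stokesWeight_le_one ha hc hy hp
  have hjet : HeatJet (heatSup (stokesWeight a c y)) :=
    heatJet_heatSup continuous_stokesWeight.measurable hk1
  have hcont : ∀ τ > 0, Continuous (heatSup (stokesWeight a c y) 1 τ) := fun τ hτ =>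
    continuous_iff_continuousAt.2 fun z => (hjet.space 1 τ hτ z).continuousAt
  set B := 4 * c * gaussConst 1 * ‖φ‖ with hB
  have hbd : ∀ τ > 0, ∀ z > 0, |heatSup (stokesWeight a c y) 1 τ z * φ z| ≤
      B * Real.exp (-((z + 0) ^ 2 / (8 * τ))) := by
    intro τ hτ z hz
    rw [abs_mul, add_zero]
    calc _ ≤ (4 * c * gaussConst 1 * Real.exp (-(z ^ 2 / (8 * τ)))) * ‖φ‖ :=
          mul_le_mul (abs_heatSup_one_le
            (fun _ hp => abs_stokesWeight_le_mul ha hc hy hp) hτ (le_of_lt hz))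
            (φ.norm_coe_le_norm z) (abs_nonneg _)
            (by have := gaussConst_nonneg 1; positivity)
      _ = _ := by rw [hB]; ring
  have hint : ∀ τ > 0, IntegrableOn (fun z => heatSup (stokesWeight a c y) 1 τ z * φ z)
      (Ioi 0) := fun τ hτ => by
    refine Integrable.mono' ((integrable_exp_neg_sq_div hτ 0).const_mul B).integrableOn
      ((hcont τ hτ).mul φ.continuous).aestronglyMeasurable ?_
    filter_upwards [ae_restrict_mem measurableSet_Ioi] with z hz using hbd τ hτ z hz
  have hlim : Tendsto (fun τ => ∫ z in Ioi (0 : ℝ), heatSup (stokesWeight a c y) 1 τ z * φ z)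
      (𝓝[>] 0) (𝓝 0) := by
    have h0 : Tendsto (fun τ => B * (Real.sqrt (8 * Real.pi) * Real.sqrt τ)) (𝓝[>] 0) (𝓝 0) := by
      have : Continuous fun τ => B * (Real.sqrt (8 * Real.pi) * Real.sqrt τ) := by fun_prop
      simpa using (this.tendsto 0).mono_left nhdsWithin_le_nhds
    refine squeeze_zero_norm' ?_ h0
    filter_upwards [self_mem_nhdsWithin] with τ hτ
    refine (norm_integral_le_of_norm_le
      ((integrable_exp_neg_sq_div hτ 0).const_mul B).integrableOn ?_).trans ?_
    · filter_upwards [ae_restrict_mem measurableSet_Ioi] with z hz using hbd τ hτ z hz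
    · rw [integral_const_mul]
      have := gaussConst_nonneg 1
      exact mul_le_mul_of_nonneg_left (integral_Ioi_exp_neg_sq_div_le hτ 0) (by positivity)
  have hsum := ((tendsto_integral_heatD_image hy φ hφ).const_mul (-2)).add (hlim.const_mul 2)
  rw [mul_zero, mul_zero, add_zero] at hsum
  refine hsum.congr' ?_
  filter_upwards [self_mem_nhdsWithin] with τ hτ
  have hi := (integrable_heatD_mul hτ y φ.continuous.measurable
    φ.norm_coe_le_norm).integrableOn (s := Ioi (0 : ℝ))
  rw [← integral_const_mul, ← integral_const_mul,
    ← integral_add (hi.const_mul _) ((hint τ hτ).const_mul _)]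
  congr 1
  funext z
  simp only [residualJet]
  ring

theorem integrableOn_residualJet_mul (ha : 0 ≤ a) (hc : 0 < c) (hy : 0 ≤ y) (φ : ℝ →ᵇ ℝ) {τ : ℝ}
    (hτ : 0 < τ) : IntegrableOn (fun z => residualJet a c y 0 τ z * φ z) (Ioi 0) := by
  obtain ⟨M, hM⟩ := bddMass_residualJet ha hc hy
  exact (hM τ hτ).1.mul_bdd φ.continuous.aestronglyMeasurable
    (Eventually.of_forall φ.norm_coe_le_norm)

theorem stokes_boundary_jet (ha : 0 ≤ a) (hc : 0 < c) (hy : 0 ≤ y) {τ : ℝ} (hτ : 0 < τ) :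
    neumannJet y 0 τ 0 + residualJet a c y 0 τ 0 =
      -(c * ∫ z in Ioi (0 : ℝ), Real.exp (-(a * z)) *
        (neumannJet y 0 τ z + residualJet a c y 0 τ z)) := by
  have hm := measurable_exp_neg_mul (a := a)
  have h1 := abs_exp_neg_mul_le_one ha
  have hk := (continuous_stokesWeight (a := a) (c := c) (y := y)).measurable
  have hk1 : ∀ p > 0, |stokesWeight a c y p| ≤ 1 :=
    fun _ hp => abs_stokesWeight_le_one ha hc hy hp
  have hmain := integral_stokesWeight_mul ha hc hy hτ
  set E := heatSup fun z => Real.exp (-(a * z)) with hE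
  have iE : ∀ x, IntegrableOn (fun z => Real.exp (-(a * z)) * heatD 0 τ (x + z)) (Ioi 0) :=
    integrableOn_heatSup hm h1 0 hτ
  have iS : IntegrableOn (fun z => Real.exp (-(a * z)) * heatSup (stokesWeight a c y) 1 τ z)
      (Ioi 0) := by
    obtain ⟨M, hM⟩ := bddMass_heatSup hk hk1
    refine (hM τ hτ).1.bdd_mul (c := 1) hm.aestronglyMeasurable ?_
    filter_upwards [ae_restrict_mem measurableSet_Ioi] with z hz using h1 z hz
  have hL : ∫ z in Ioi (0 : ℝ), Real.exp (-(a * z)) *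
        (neumannJet y 0 τ z + residualJet a c y 0 τ z) =
      E 0 τ (-y) - E 0 τ y + 2 * ∫ p in Ioi (0 : ℝ), stokesWeight a c y p * E 1 τ p := by
    rw [hE, ← integral_exp_mul_heatSup ha hk hk1 hτ]
    simp only [heatSup.eq_def (fun z => Real.exp (-(a * z)))]
    rw [← integral_const_mul, ← integral_sub (iE (-y)) (iE y)]
    refine Eq.trans ?_ (integral_add ((iE (-y)).sub (iE y)) (iS.const_mul 2))
    congr 1
    funext z
    simp only [neumannJet, residualJet, zero_add]
    rw [add_comm z (-y), add_comm z y]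
    ring
  have i1 := integrableOn_heatSup hk hk1 1 hτ 0
  simp only [zero_add] at i1
  have i2 : IntegrableOn (fun p => stokesWeight a c y p * E 1 τ p) (Ioi 0) := by
    obtain ⟨M, hM⟩ := bddMass_heatSup hm h1
    refine (hM τ hτ).1.bdd_mul (c := 1) hk.aestronglyMeasurable ?_
    filter_upwards [ae_restrict_mem measurableSet_Ioi] with z hz using hk1 z hz
  have hsplit : ∫ p in Ioi (0 : ℝ), stokesWeight a c y p * (heatD 1 τ p + c * E 1 τ p) =
      heatSup (stokesWeight a c y) 1 τ 0 +
        c * ∫ p in Ioi (0 : ℝ), stokesWeight a c y p * E 1 τ p := by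
    simp only [heatSup.eq_def (stokesWeight a c y), zero_add]
    rw [← integral_const_mul, ← integral_add i1 (i2.const_mul c)]
    congr 1
    funext p
    ring
  rw [hL, neumannJet, residualJet]
  simp only [zero_add, heatD_zero_neg]
  rw [hsplit] at hmain
  linear_combination 2 * hmain

end Residual

/-- The residual kernel `R_α = G_α - H_α`. -/
noncomputable def stokesR (ν : ℝ) (α : ℤ) (t z y : ℝ) : ℝ :=
  Real.exp (-((α : ℝ) ^ 2 * ν * t)) * residualJet |(α : ℝ)| ν⁻¹ y 0 (ν * t) z

theorem isStokesGreen_stokesH_add_stokesR {ν : ℝ} (hν : 0 < ν) (α : ℤ) :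
    IsStokesGreen ν α fun t z y => stokesH ν α t z y + stokesR ν α t z y := by
  have ha : 0 ≤ |(α : ℝ)| := abs_nonneg _
  have hc : 0 < ν⁻¹ := inv_pos.2 hν
  have e : ∀ t > 0, ∀ z y, stokesH ν α t z y + stokesR ν α t z y =
      Real.exp (-((α : ℝ) ^ 2 * ν * t)) *
        (neumannJet y 0 (ν * t) z + residualJet |(α : ℝ)| ν⁻¹ y 0 (ν * t) z) := by
    intro t ht z y
    rw [stokesH_eq hν α ht, stokesR]
    ring
  refine ⟨fun y hy => ?_, fun y hy t ht => ?_, fun y hy φ hφ => ?_⟩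
  · exact (((heatJet_neumannJet y).add (heatJet_residualJet ha hc hy)).isL1HeatSolution
      ((bddMass_neumannJet y).add (bddMass_residualJet ha hc hy)) hν α).congr
      fun t ht => funext fun z => e t ht z y
  · simp only [e t ht, mul_left_comm (Real.exp (-(|(α : ℝ)| * _)))]
    rw [integral_const_mul, stokes_boundary_jet ha hc hy (mul_pos hν ht)]
    field_simp
  · have h := (tendsto_integral_neumannJet hy φ).add
      (tendsto_integral_residualJet ha hc hy φ hφ)
    rw [add_zero] at h
    refine (tendsto_damped_mul hν α h).congr' ?_
    filter_upwards [self_mem_nhdsWithin] with t ht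
    have hτ : 0 < ν * t := mul_pos hν ht
    rw [← integral_add (integrableOn_neumannJet_mul hτ y φ)
      (integrableOn_residualJet_mul ha hc hy φ hτ), ← integral_const_mul]
    congr 1
    funext z
    rw [e t ht]
    ring

/-! ### Uniqueness for the Laplace transform -/

theorem Real.hasSum_exp_series (x : ℝ) : HasSum (fun k : ℕ => x ^ k / k.factorial) (Real.exp x) := by
  rw [Real.exp_eq_exp_ℝ]
  exact NormedSpace.expSeries_div_hasSum_exp x

/-- Expanding the outer exponential expresses the integral of `f` against the Gumbel profile
`exp(-e^{n(s-x)})` through exponential moments of `f`. If these are bounded by those of a mass at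
`x₀ < x`, then only the zeroth term of the expansion survives as `n → ∞`. -/
theorem abs_integral_gumbel_sub_le {f : ℝ → ℝ} (hf : Integrable f) {S : ℝ}
    (hS : ∀ s > S, f s = 0) {M x₀ : ℝ}
    (hM : ∀ n : ℕ, 1 ≤ n → |∫ s, Real.exp (n * s) * f s| ≤ M * Real.exp (n * x₀))
    (x : ℝ) {n : ℕ} (hn : 1 ≤ n) :
    |(∫ s, f s * Real.exp (-Real.exp (n * (s - x)))) - ∫ s, f s| ≤
      M * (Real.exp (Real.exp (n * (x₀ - x))) - 1) := by
  set F : ℕ → ℝ → ℝ := fun k s => f s * ((-Real.exp (n * (s - x))) ^ k / k.factorial) with hF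
  set E := Real.exp (n * (S - x)) with hE
  have hbd : ∀ k s, ‖F k s‖ ≤ |f s| * (E ^ k / k.factorial) := by
    intro k s
    rcases le_or_gt s S with h | h
    · rw [hF, norm_mul, Real.norm_eq_abs, Real.norm_eq_abs, abs_div, abs_pow, abs_neg,
        Real.abs_exp, Nat.abs_cast]
      gcongr
      rw [hE]
      gcongr
    · simp [hF, hS s h]
  have hmeas : ∀ k, AEStronglyMeasurable (F k) := fun k => by
    refine hf.aestronglyMeasurable.mul (Continuous.aestronglyMeasurable ?_)
    fun_prop
  have hint : ∀ k, Integrable (F k) := fun k =>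
    Integrable.mono' (hf.abs.mul_const _) (hmeas k) (Eventually.of_forall (hbd k))
  have hsum : Summable fun k => ∫ s, ‖F k s‖ := by
    refine Summable.of_nonneg_of_le (fun k => integral_nonneg fun s => norm_nonneg _)
      (fun k => ?_) ((Real.summable_pow_div_factorial E).mul_left (∫ s, |f s|))
    rw [← integral_mul_const]
    exact integral_mono (hint k).norm (hf.abs.mul_const _) (hbd k)
  have h := hasSum_integral_of_summable_integral_norm hint hsum
  have htsum : ∀ s, ∑' k, F k s = f s * Real.exp (-Real.exp (n * (s - x))) := fun s =>
    ((Real.hasSum_exp_series _).mul_left (f s)).tsum_eq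
  simp only [htsum] at h
  have h0 : ∫ s, F 0 s = ∫ s, f s := by simp [hF]
  have h' := (hasSum_nat_add_iff' 1).2 h
  rw [Finset.sum_range_one, h0] at h'
  have hg := (hasSum_nat_add_iff' 1).2 (Real.hasSum_exp_series (Real.exp (n * (x₀ - x))))
  rw [Finset.sum_range_one, pow_zero, Nat.factorial_zero, Nat.cast_one, div_one] at hg
  refine h'.norm_le_of_bounded (hg.mul_left M) fun k => ?_
  have e : ∀ s, F (k + 1) s = ((-1) ^ (k + 1) * Real.exp (-(((k + 1) * n : ℕ) * x)) /
      (k + 1).factorial) * (Real.exp (((k + 1) * n : ℕ) * s) * f s) := by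
    intro s
    have : (Real.exp (n * (s - x))) ^ (k + 1) =
        Real.exp (-(((k + 1) * n : ℕ) * x)) * Real.exp (((k + 1) * n : ℕ) * s) := by
      rw [← Real.exp_nat_mul, ← Real.exp_add]
      push_cast
      ring_nf
    simp only [hF]
    rw [neg_pow, this]
    ring
  simp only [e]
  rw [integral_const_mul, norm_mul, Real.norm_eq_abs, Real.norm_eq_abs, abs_div, abs_mul, abs_pow,
    abs_neg, abs_one, one_pow, one_mul, Real.abs_exp, Nat.abs_cast]
  have h1 := hM ((k + 1) * n) (Nat.mul_pos (Nat.succ_pos k) hn)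
  have e2 : Real.exp (n * (x₀ - x)) ^ (k + 1) =
      Real.exp (-(((k + 1) * n : ℕ) * x)) * Real.exp (((k + 1) * n : ℕ) * x₀) := by
    rw [← Real.exp_nat_mul, ← Real.exp_add]
    push_cast
    ring_nf
  rw [e2]
  calc _ ≤ Real.exp (-(((k + 1) * n : ℕ) * x)) / (k + 1).factorial *
        (M * Real.exp (((k + 1) * n : ℕ) * x₀)) := by gcongr
    _ = _ := by ring

/-- A function with exponential moments of the size of those of a mass at `x₀` has no mass to the
right of `x₀`: the Gumbel profiles converge to the indicator function of `(-∞, x)`, yet the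
integrals against them converge to the whole integral. -/
theorem integral_Ioi_eq_zero_of_exp_moments {f : ℝ → ℝ} (hf : Integrable f) {S : ℝ}
    (hS : ∀ s > S, f s = 0) {M x₀ : ℝ}
    (hM : ∀ n : ℕ, 1 ≤ n → |∫ s, Real.exp (n * s) * f s| ≤ M * Real.exp (n * x₀))
    {x : ℝ} (hx : x₀ < x) : ∫ s in Ioi x, f s = 0 := by
  have hlin : ∀ c : ℝ, 0 < c → Tendsto (fun n : ℕ => (n : ℝ) * c) atTop atTop := fun c hc =>
    tendsto_natCast_atTop_atTop.atTop_mul_const hc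
  have h1 : Tendsto (fun n : ℕ => ∫ s, f s * Real.exp (-Real.exp (n * (s - x)))) atTop
      (𝓝 (∫ s, (Iio x).indicator f s)) := by
    refine tendsto_integral_of_dominated_convergence (fun s => |f s|) (fun n => ?_) hf.abs
      (fun n => Eventually.of_forall fun s => ?_) ?_
    · refine hf.aestronglyMeasurable.mul (Continuous.aestronglyMeasurable ?_)
      fun_prop
    · rw [norm_mul, Real.norm_eq_abs, Real.norm_eq_abs, Real.abs_exp]
      exact mul_le_of_le_one_right (abs_nonneg _)
        (Real.exp_le_one_iff.2 (neg_nonpos.2 (Real.exp_pos _).le))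
    · filter_upwards [compl_mem_ae_iff.2 (measure_singleton x)] with s hs
      rcases lt_or_gt_of_ne (show s ≠ x from hs) with h | h
      · have e0 : Tendsto (fun n : ℕ => Real.exp (n * (s - x))) atTop (𝓝 0) := by
          refine (Real.tendsto_exp_neg_atTop_nhds_zero.comp (hlin (x - s) (by linarith))).congr
            fun n => ?_
          simp only [Function.comp]
          ring_nf
        have := ((Real.continuous_exp.tendsto _).comp e0.neg).const_mul (f s)
        simpa [indicator_of_mem (show s ∈ Iio x from h)] using this
      · have e0 : Tendsto (fun n : ℕ => Real.exp (n * (s - x))) atTop atTop :=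
          Real.tendsto_exp_atTop.comp (hlin (s - x) (by linarith))
        have := (Real.tendsto_exp_neg_atTop_nhds_zero.comp e0).const_mul (f s)
        simpa [indicator_of_notMem (show s ∉ Iio x from not_lt.2 (le_of_lt h))] using this
  have h2 : Tendsto (fun n : ℕ => (∫ s, f s * Real.exp (-Real.exp (n * (s - x)))) - ∫ s, f s)
      atTop (𝓝 0) := by
    have e0 : Tendsto (fun n : ℕ => Real.exp (n * (x₀ - x))) atTop (𝓝 0) := by
      refine (Real.tendsto_exp_neg_atTop_nhds_zero.comp (hlin (x - x₀) (by linarith))).congr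
        fun n => ?_
      simp only [Function.comp]
      ring_nf
    have e1 := (((Real.continuous_exp.tendsto _).comp e0).sub_const 1).const_mul M
    rw [Real.exp_zero, sub_self, mul_zero] at e1
    refine squeeze_zero_norm' ?_ e1
    filter_upwards [eventually_ge_atTop 1] with n hn
    exact abs_integral_gumbel_sub_le hf hS hM x hn
  have h3 := tendsto_nhds_unique h2 (h1.sub_const _)
  rw [integral_indicator measurableSet_Iio, ← integral_Iic_eq_integral_Iio,
    ← intervalIntegral.integral_Iic_add_Ioi (b := x) hf.integrableOn hf.integrableOn] at h3
  linarith

theorem eq_zero_of_exp_moments {f : ℝ → ℝ} (hf : Integrable f) {S : ℝ}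
    (hS : ∀ s > S, f s = 0) {M x₀ : ℝ}
    (hM : ∀ n : ℕ, 1 ≤ n → |∫ s, Real.exp (n * s) * f s| ≤ M * Real.exp (n * x₀))
    {x : ℝ} (hx : x₀ < x) (hc : ContinuousAt f x) : f x = 0 := by
  have h := intervalIntegral.integral_hasDerivAt_right (hf.intervalIntegrable (a := x) (b := x))
    hf.aestronglyMeasurable.stronglyMeasurableAtFilter hc
  refine h.unique ((hasDerivAt_const x (0 : ℝ)).congr_of_eventuallyEq ?_)
  filter_upwards [Ioi_mem_nhds hx] with y hy
  have := intervalIntegral.integral_interval_add_Ioi (a := x) (b := y) hf.integrableOn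
    hf.integrableOn
  rw [integral_Ioi_eq_zero_of_exp_moments hf hS hM hy,
    integral_Ioi_eq_zero_of_exp_moments hf hS hM hx] at this
  linarith

/-! ### The weak form of the equation up to the boundary -/

section WeakForm

variable {ν : ℝ} {α : ℤ} {u : ℝ → ℝ → ℝ}

theorem IsL1HeatSolution.hasDerivAt_space (hu : IsL1HeatSolution ν α u) {t z : ℝ} (ht : 0 < t)
    (hz : 0 < z) : HasDerivAt (u t) (deriv (u t) z) z ∧
      HasDerivAt (deriv (u t)) (iteratedDeriv 2 (u t) z) z := by
  have h := hu.contDiffOn_space t ht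
  rw [show (2 : WithTop ℕ∞) = 1 + 1 from rfl, contDiffOn_succ_iff_deriv_of_isOpen isOpen_Ioi] at h
  have hn : Ioi (0 : ℝ) ∈ 𝓝 z := Ioi_mem_nhds hz
  refine ⟨(h.1.differentiableAt hn).hasDerivAt, ?_⟩
  rw [iteratedDeriv_succ, iteratedDeriv_one]
  exact ((h.2.2.differentiableOn one_ne_zero).differentiableAt hn).hasDerivAt

theorem IsL1HeatSolution.continuousOn_iteratedDeriv (hu : IsL1HeatSolution ν α u) {t : ℝ}
    (ht : 0 < t) : ContinuousOn (iteratedDeriv 2 (u t)) (Ioi 0) := by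
  have h := hu.contDiffOn_space t ht
  rw [show (2 : WithTop ℕ∞) = 1 + 1 from rfl, contDiffOn_succ_iff_deriv_of_isOpen isOpen_Ioi,
    show (1 : WithTop ℕ∞) = 0 + 1 from rfl, contDiffOn_succ_iff_deriv_of_isOpen isOpen_Ioi] at h
  rw [iteratedDeriv_succ, iteratedDeriv_one]
  exact h.2.2.2.2.continuousOn

/-- Extension by clamping, which makes a function continuous on a closed quadrant globally
continuous. -/
theorem continuous_clamp {f : ℝ × ℝ → ℝ} {s x : ℝ}
    (hf : ContinuousOn f (Ici s ×ˢ Ici x)) : Continuous fun p : ℝ × ℝ => f (max p.1 s, max p.2 x) :=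
  hf.comp_continuous (f := fun p : ℝ × ℝ => (max p.1 s, max p.2 x)) (by fun_prop)
    fun p => ⟨le_max_right p.1 s, le_max_right p.2 x⟩

/-- Two integrations by parts on `[c, c + N]`, against a test function vanishing at both ends and
with vanishing derivative at the right one. -/
theorem IsL1HeatSolution.integral_iteratedDeriv_mul (hu : IsL1HeatSolution ν α u)
    {θ θ' θ'' : ℝ → ℝ} (hθ : ∀ x, HasDerivAt θ (θ' x) x) (hθ' : ∀ x, HasDerivAt θ' (θ'' x) x)
    (hθc : Continuous θ'') {N : ℝ} (hN : 0 ≤ N) (h0 : θ 0 = 0) (hN0 : θ N = 0) (hN1 : θ' N = 0)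
    {c s : ℝ} (hc : 0 < c) (hs : 0 < s) :
    ∫ x in (0 : ℝ)..N, iteratedDeriv 2 (u s) (c + x) * θ x =
      (∫ x in (0 : ℝ)..N, u s (c + x) * θ'' x) + u s c * θ' 0 := by
  have hmaps : MapsTo (fun x : ℝ => c + x) (uIcc 0 N) (Ioi 0) := fun x hx => by
    rw [uIcc_of_le hN] at hx
    exact add_pos_of_pos_of_nonneg hc hx.1
  have hd : ∀ x ∈ uIcc 0 N, HasDerivAt (fun x => deriv (u s) (c + x) * θ x - u s (c + x) * θ' x)
      (iteratedDeriv 2 (u s) (c + x) * θ x - u s (c + x) * θ'' x) x := fun x hx => by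
    obtain ⟨d1, d2⟩ := hu.hasDerivAt_space hs (hmaps hx)
    refine (((d2.comp_const_add c x).fun_mul (hθ x)).fun_sub
      ((d1.comp_const_add c x).fun_mul (hθ' x))).congr_deriv ?_
    ring
  have hcθ : Continuous θ := continuous_iff_continuousAt.2 fun x => (hθ x).continuousAt
  have i1 : IntervalIntegrable (fun x => iteratedDeriv 2 (u s) (c + x) * θ x) volume 0 N :=
    (((hu.continuousOn_iteratedDeriv hs).comp (by fun_prop) hmaps).mul
      hcθ.continuousOn).intervalIntegrable
  have i2 : IntervalIntegrable (fun x => u s (c + x) * θ'' x) volume 0 N :=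
    (((hu.contDiffOn_space s hs).continuousOn.comp (by fun_prop) hmaps).mul
      hθc.continuousOn).intervalIntegrable
  have h := intervalIntegral.integral_eq_sub_of_hasDerivAt hd (i1.sub i2)
  rw [intervalIntegral.integral_sub i1 i2, h0, hN0, hN1, add_zero] at h
  linarith

/-- The weak form away from the boundary, where the solution is known to be smooth. -/
theorem IsL1HeatSolution.weak_form_interior (hu : IsL1HeatSolution ν α u)
    {θ θ' θ'' : ℝ → ℝ} (hθ : ∀ x, HasDerivAt θ (θ' x) x) (hθ' : ∀ x, HasDerivAt θ' (θ'' x) x)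
    (hθc : Continuous θ'') {N : ℝ} (hN : 0 ≤ N) (h0 : θ 0 = 0) (hN0 : θ N = 0) (hN1 : θ' N = 0)
    {c t₁ t₂ : ℝ} (hc : 0 < c) (ht₁ : 0 < t₁) (ht : t₁ ≤ t₂) :
    ∫ x in (0 : ℝ)..N, (u t₂ (c + x) - u t₁ (c + x)) * θ x =
      ∫ s in t₁..t₂, ν * ((∫ x in (0 : ℝ)..N, u s (c + x) * (θ'' x - (α : ℝ) ^ 2 * θ x)) +
        u s c * θ' 0) := by
  have hcθ : Continuous θ := continuous_iff_continuousAt.2 fun x => (hθ x).continuousAt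
  set w : ℝ → ℝ → ℝ := fun s z => deriv (fun s => u s z) s with hw
  have hwc : Continuous fun p : ℝ × ℝ => w (max p.1 t₁) (max p.2 c) :=
    continuous_clamp (f := fun p => w p.1 p.2)
      (hu.continuousOn_time_deriv.mono (prod_mono (Ici_subset_Ioi.2 ht₁) (Ici_subset_Ioi.2 hc)))
  -- the time derivative on the rectangle, clamped
  set v : ℝ → ℝ → ℝ := fun s x => w (max s t₁) (max (c + x) c) * θ x with hv
  have hvc : Continuous (Function.uncurry v) :=
    (hwc.comp (f := fun q : ℝ × ℝ => (q.1, c + q.2)) (by fun_prop)).mul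
      (hcθ.comp continuous_snd)
  have hv_eq : ∀ s ≥ t₁, ∀ x ≥ 0, v s x = w s (c + x) * θ x := fun s hs x hx => by
    simp only [hv]
    rw [max_eq_left hs, max_eq_left (le_add_of_nonneg_right hx)]
  have hx_int : ∀ x ∈ uIcc 0 N, (u t₂ (c + x) - u t₁ (c + x)) * θ x = ∫ s in t₁..t₂, v s x := by
    intro x hx
    rw [uIcc_of_le hN] at hx
    have hpos : 0 < c + x := add_pos_of_pos_of_nonneg hc hx.1
    have hd : ∀ s ∈ uIcc t₁ t₂, HasDerivAt (fun s => u s (c + x) * θ x) (v s x) s := by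
      intro s hs
      rw [uIcc_of_le ht] at hs
      rw [hv_eq s hs.1 x hx.1]
      exact (hu.differentiableAt_time s (ht₁.trans_le hs.1) _ hpos).hasDerivAt.mul_const _
    rw [intervalIntegral.integral_eq_sub_of_hasDerivAt hd
      (Continuous.intervalIntegrable (hvc.comp (by fun_prop : Continuous fun s : ℝ => (s, x))) _ _)]
    ring
  have hswap : IntegrableOn (Function.uncurry fun x s => v s x) (uIoc 0 N ×ˢ uIoc t₁ t₂) :=
    ((hvc.comp continuous_swap).continuousOn.integrableOn_compact
      (isCompact_uIcc.prod isCompact_uIcc)).mono_set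
      (prod_mono uIoc_subset_uIcc uIoc_subset_uIcc)
  rw [intervalIntegral.integral_congr hx_int, intervalIntegral_intervalIntegral_swap hswap]
  refine intervalIntegral.integral_congr fun s hs => ?_
  rw [uIcc_of_le ht] at hs
  have hs0 : 0 < s := ht₁.trans_le hs.1
  have hmaps : MapsTo (fun x : ℝ => c + x) (uIcc 0 N) (Ioi 0) := fun x hx => by
    rw [uIcc_of_le hN] at hx
    exact add_pos_of_pos_of_nonneg hc hx.1
  have hcu : ContinuousOn (fun x => u s (c + x)) (uIcc 0 N) :=
    (hu.contDiffOn_space s hs0).continuousOn.comp (by fun_prop) hmaps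
  have i0 : IntervalIntegrable (fun x => iteratedDeriv 2 (u s) (c + x) * θ x) volume 0 N :=
    (((hu.continuousOn_iteratedDeriv hs0).comp (by fun_prop) hmaps).mul
      hcθ.continuousOn).intervalIntegrable
  have i1 : IntervalIntegrable (fun x => u s (c + x) * θ x) volume 0 N :=
    (hcu.mul hcθ.continuousOn).intervalIntegrable
  have i2 : IntervalIntegrable (fun x => u s (c + x) * θ'' x) volume 0 N :=
    (hcu.mul hθc.continuousOn).intervalIntegrable
  have e1 : ∫ x in (0 : ℝ)..N, v s x = ∫ x in (0 : ℝ)..N,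
      (ν * (iteratedDeriv 2 (u s) (c + x) * θ x) - ν * (α : ℝ) ^ 2 * (u s (c + x) * θ x)) := by
    refine intervalIntegral.integral_congr fun x hx => ?_
    have hpos : 0 < c + x := hmaps hx
    rw [uIcc_of_le hN] at hx
    rw [hv_eq s hs.1 x hx.1]
    simp only [hw]
    rw [hu.equation s hs0 _ hpos]
    ring
  have e2 : ∫ x in (0 : ℝ)..N, u s (c + x) * (θ'' x - (α : ℝ) ^ 2 * θ x) =
      (∫ x in (0 : ℝ)..N, u s (c + x) * θ'' x) -
        (α : ℝ) ^ 2 * ∫ x in (0 : ℝ)..N, u s (c + x) * θ x := by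
    rw [← intervalIntegral.integral_const_mul, ← intervalIntegral.integral_sub i2 (i1.const_mul _)]
    congr 1
    funext x
    ring
  change ∫ x in (0 : ℝ)..N, v s x = _
  rw [e1, intervalIntegral.integral_sub (i0.const_mul _) (i1.const_mul _),
    intervalIntegral.integral_const_mul, intervalIntegral.integral_const_mul,
    hu.integral_iteratedDeriv_mul hθ hθ' hθc hN h0 hN0 hN1 hc hs0, e2]
  ring

/-- The weak form up to the boundary: only the continuity of the solution at `z = 0` is used, its
normal derivative does not appear because the test function vanishes there. -/
theorem IsL1HeatSolution.weak_form_interval (hu : IsL1HeatSolution ν α u)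
    {θ θ' θ'' : ℝ → ℝ} (hθ : ∀ x, HasDerivAt θ (θ' x) x) (hθ' : ∀ x, HasDerivAt θ' (θ'' x) x)
    (hθc : Continuous θ'') {N : ℝ} (hN : 0 ≤ N) (h0 : θ 0 = 0) (hN0 : θ N = 0) (hN1 : θ' N = 0)
    {t₁ t₂ : ℝ} (ht₁ : 0 < t₁) (ht : t₁ ≤ t₂) :
    ∫ x in (0 : ℝ)..N, (u t₂ x - u t₁ x) * θ x =
      ∫ s in t₁..t₂, ν * ((∫ x in (0 : ℝ)..N, u s x * (θ'' x - (α : ℝ) ^ 2 * θ x)) +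
        u s 0 * θ' 0) := by
  have hcθ : Continuous θ := continuous_iff_continuousAt.2 fun x => (hθ x).continuousAt
  set U : ℝ → ℝ → ℝ := fun s z => u (max s t₁) (max z 0) with hU
  have hUc : Continuous fun p : ℝ × ℝ => U p.1 p.2 :=
    continuous_clamp (f := fun p => u p.1 p.2)
      (hu.continuousOn.mono (prod_mono_left (Ici_subset_Ioi.2 ht₁)))
  have hU_eq : ∀ s ≥ t₁, ∀ x ≥ 0, U s x = u s x := fun s hs x hx => by
    simp only [hU]
    rw [max_eq_left hs, max_eq_left hx]
  set l : ℝ → ℝ := fun c => ∫ x in (0 : ℝ)..N, (U t₂ (c + x) - U t₁ (c + x)) * θ x with hl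
  set r : ℝ → ℝ := fun c => ∫ s in t₁..t₂, ν * ((∫ x in (0 : ℝ)..N,
    U s (c + x) * (θ'' x - (α : ℝ) ^ 2 * θ x)) + U s c * θ' 0) with hr
  have hcl : Continuous l := by
    refine intervalIntegral.continuous_parametric_intervalIntegral_of_continuous' ?_ 0 N
    refine Continuous.mul (Continuous.sub ?_ ?_) (hcθ.comp continuous_snd)
    · exact hUc.comp (f := fun q : ℝ × ℝ => (t₂, q.1 + q.2)) (by fun_prop)
    · exact hUc.comp (f := fun q : ℝ × ℝ => (t₁, q.1 + q.2)) (by fun_prop)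
  have hcr : Continuous r := by
    refine intervalIntegral.continuous_parametric_intervalIntegral_of_continuous' ?_ t₁ t₂
    refine continuous_const.mul (Continuous.add ?_ (Continuous.mul ?_ continuous_const))
    · refine intervalIntegral.continuous_parametric_intervalIntegral_of_continuous'
        (f := fun (q : ℝ × ℝ) x => U q.2 (q.1 + x) * (θ'' x - (α : ℝ) ^ 2 * θ x)) ?_ 0 N
      refine Continuous.mul ?_ ((hθc.sub (continuous_const.mul hcθ)).comp continuous_snd)
      exact hUc.comp (f := fun q : (ℝ × ℝ) × ℝ => (q.1.2, q.1.1 + q.2)) (by fun_prop)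
    · exact hUc.comp (f := fun q : ℝ × ℝ => (q.2, q.1)) (by fun_prop)
  have hl_eq : ∀ c ≥ 0, l c = ∫ x in (0 : ℝ)..N, (u t₂ (c + x) - u t₁ (c + x)) * θ x := by
    intro c hc
    refine intervalIntegral.integral_congr fun x hx => ?_
    rw [uIcc_of_le hN] at hx
    rw [hU_eq t₂ ht _ (add_nonneg hc hx.1), hU_eq t₁ le_rfl _ (add_nonneg hc hx.1)]
  have hr_eq : ∀ c ≥ 0, r c = ∫ s in t₁..t₂, ν * ((∫ x in (0 : ℝ)..N,
      u s (c + x) * (θ'' x - (α : ℝ) ^ 2 * θ x)) + u s c * θ' 0) := by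
    intro c hc
    refine intervalIntegral.integral_congr fun s hs => ?_
    rw [uIcc_of_le ht] at hs
    rw [hU_eq s hs.1 c hc]
    congr 2
    refine intervalIntegral.integral_congr fun x hx => ?_
    rw [uIcc_of_le hN] at hx
    rw [hU_eq s hs.1 _ (add_nonneg hc hx.1)]
  have hlr : l 0 = r 0 := by
    refine tendsto_nhds_unique ((hcl.tendsto 0).mono_left nhdsWithin_le_nhds)
      (((hcr.tendsto 0).mono_left nhdsWithin_le_nhds).congr' ?_) (l := 𝓝[>] 0)
    filter_upwards [self_mem_nhdsWithin] with c hc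
    rw [hl_eq c (le_of_lt hc), hr_eq c (le_of_lt hc)]
    exact (hu.weak_form_interior hθ hθ' hθc hN h0 hN0 hN1 hc ht₁ ht).symm
  rw [hl_eq 0 le_rfl, hr_eq 0 le_rfl] at hlr
  simpa only [zero_add] using hlr

/-- Integrals over `(0, N]` against weights that converge and stay bounded. -/
theorem tendsto_intervalIntegral_mul {f : ℝ → ℝ} (hf : IntegrableOn f (Ioi 0)) {g : ℕ → ℝ → ℝ}
    {g₀ : ℝ → ℝ} (hg : ∀ n, Continuous (g n)) {K : ℝ} {N : ℕ → ℝ} (hN : Tendsto N atTop atTop)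
    (hN0 : ∀ n, 0 ≤ N n)
    (hK : ∀ n x, 0 ≤ x → x ≤ N n → |g n x| ≤ K)
    (hlim : ∀ x > 0, Tendsto (fun n => g n x) atTop (𝓝 (g₀ x))) :
    Tendsto (fun n => ∫ x in (0 : ℝ)..N n, f x * g n x) atTop
      (𝓝 (∫ x in Ioi (0 : ℝ), f x * g₀ x)) := by
  have e : ∀ n, ∫ x in (0 : ℝ)..N n, f x * g n x =
      ∫ x in Ioi (0 : ℝ), (Iic (N n)).indicator (fun x => f x * g n x) x := by
    intro n
    rw [intervalIntegral.integral_of_le (hN0 n), setIntegral_indicator measurableSet_Iic,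
      Ioi_inter_Iic]
  simp only [e]
  refine tendsto_integral_of_dominated_convergence (fun x => |f x| * K) (fun n => ?_)
    (hf.abs.mul_const K) (fun n => ?_) ?_
  · exact (hf.aestronglyMeasurable.mul (hg n).aestronglyMeasurable).indicator measurableSet_Iic
  · filter_upwards [ae_restrict_mem measurableSet_Ioi] with x hx
    by_cases h : x ∈ Iic (N n)
    · rw [indicator_of_mem h, norm_mul]
      exact mul_le_mul_of_nonneg_left (hK n x (le_of_lt hx) h) (abs_nonneg _)
    · rw [indicator_of_notMem h, norm_zero]
      have hK0 := (abs_nonneg _).trans (hK n 0 le_rfl (hN0 n))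
      positivity
  · filter_upwards [ae_restrict_mem measurableSet_Ioi] with x hx
    refine ((hlim x hx).const_mul (f x)).congr' ?_
    filter_upwards [hN.eventually_ge_atTop x] with n hn
    exact (indicator_of_mem (show x ∈ Iic (N n) from hn) (f := fun x => f x * g n x)).symm

/-- The weak form on the half-line. The test function is truncated by the factor `(1 - x/N)²`,
which vanishes to second order at `N`; no decay of the solution beyond its integrability is
needed. -/
theorem IsL1HeatSolution.weak_form (hu : IsL1HeatSolution ν α u)
    {ψ ψ' ψ'' : ℝ → ℝ} (hψ : ∀ x, HasDerivAt ψ (ψ' x) x) (hψ' : ∀ x, HasDerivAt ψ' (ψ'' x) x)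
    (hψc : Continuous ψ'') (h0 : ψ 0 = 0) {K : ℝ}
    (hK : ∀ x ≥ 0, |ψ x| ≤ K ∧ |ψ' x| ≤ K ∧ |ψ'' x| ≤ K)
    {t₁ t₂ : ℝ} (ht₁ : 0 < t₁) (ht : t₁ ≤ t₂) :
    (∫ x in Ioi (0 : ℝ), u t₂ x * ψ x) - ∫ x in Ioi (0 : ℝ), u t₁ x * ψ x =
      ∫ s in t₁..t₂, ν * ((∫ x in Ioi (0 : ℝ), u s x * (ψ'' x - (α : ℝ) ^ 2 * ψ x)) +
        u s 0 * ψ' 0) := by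
  have hK0 : 0 ≤ K := (abs_nonneg _).trans (hK 0 le_rfl).1
  have ht₂ : 0 < t₂ := ht₁.trans_le ht
  obtain ⟨M, hM⟩ := hu.l1_bounded t₂ ht₂
  have hcψ : Continuous ψ := continuous_iff_continuousAt.2 fun x => (hψ x).continuousAt
  have hcψ' : Continuous ψ' := continuous_iff_continuousAt.2 fun x => (hψ' x).continuousAt
  set N : ℕ → ℝ := fun n => (n : ℝ) + 1 with hN
  have hN1 : ∀ n, 1 ≤ N n := fun n => by simp [hN]
  have hNt : Tendsto N atTop atTop := tendsto_atTop_add_const_right _ 1 tendsto_natCast_atTop_atTop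
  have hNpos : ∀ n, 0 < N n := fun n => one_pos.trans_le (hN1 n)
  have hNinv : Tendsto (fun n => (N n)⁻¹) atTop (𝓝 0) := hNt.inv_tendsto_atTop
  set χ : ℕ → ℝ → ℝ := fun n x => 1 - x * (N n)⁻¹ with hχ
  have hdχ : ∀ n x, HasDerivAt (χ n) (-(N n)⁻¹) x := fun n x => by
    refine (((hasDerivAt_id x).mul_const (N n)⁻¹).const_sub 1).congr_deriv ?_
    ring
  have hχlim : ∀ x, Tendsto (fun n => χ n x) atTop (𝓝 1) := fun x => by
    simpa using (hNinv.const_mul x).const_sub 1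
  have hχbd : ∀ n x, 0 ≤ x → x ≤ N n → |χ n x| ≤ 1 := fun n x hx hxN => by
    have h1 : 0 ≤ x * (N n)⁻¹ := mul_nonneg hx (inv_nonneg.2 (hNpos n).le)
    have h2 : x * (N n)⁻¹ ≤ 1 := by
      rw [← div_eq_mul_inv]
      exact (div_le_one (hNpos n)).2 hxN
    rw [abs_le]
    constructor <;> simp only [hχ] <;> linarith
  have hχN : ∀ n, χ n (N n) = 0 := fun n => by
    simp only [hχ]
    rw [mul_inv_cancel₀ (hNpos n).ne', sub_self]
  have hcχ : ∀ n, Continuous (χ n) := fun n =>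
    continuous_iff_continuousAt.2 fun x => (hdχ n x).continuousAt
  set θ : ℕ → ℝ → ℝ := fun n x => ψ x * χ n x ^ 2 with hθ
  set θ' : ℕ → ℝ → ℝ := fun n x => ψ' x * χ n x ^ 2 - 2 * (N n)⁻¹ * (ψ x * χ n x) with hθ'
  set θ'' : ℕ → ℝ → ℝ := fun n x => ψ'' x * χ n x ^ 2 - 4 * (N n)⁻¹ * (ψ' x * χ n x) +
    2 * (N n)⁻¹ ^ 2 * ψ x with hθ''
  have hdθ : ∀ n x, HasDerivAt (θ n) (θ' n x) x := fun n x => by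
    refine ((hψ x).fun_mul ((hdχ n x).fun_pow 2)).congr_deriv ?_
    simp only [hθ']
    push_cast
    ring
  have hdθ' : ∀ n x, HasDerivAt (θ' n) (θ'' n x) x := fun n x => by
    refine (((hψ' x).fun_mul ((hdχ n x).fun_pow 2)).fun_sub
      (((hψ x).fun_mul (hdχ n x)).const_mul (2 * (N n)⁻¹))).congr_deriv ?_
    simp only [hθ'']
    push_cast
    ring
  have hcθ'' : ∀ n, Continuous (θ'' n) := fun n => by
    have := hcχ n
    simp only [hθ'']
    fun_prop
  have hcθ : ∀ n, Continuous (θ n) := fun n =>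
    continuous_iff_continuousAt.2 fun x => (hdθ n x).continuousAt
  have hbθ : ∀ n x, 0 ≤ x → x ≤ N n → |θ n x| ≤ K := fun n x hx hxN => by
    simp only [hθ]
    rw [abs_mul, abs_pow]
    calc _ ≤ K * 1 ^ 2 := by
          gcongr
          · exact (hK x hx).1
          · exact hχbd n x hx hxN
      _ = K := by ring
  have hbg : ∀ n x, 0 ≤ x → x ≤ N n →
      |θ'' n x - (α : ℝ) ^ 2 * θ n x| ≤ (7 + (α : ℝ) ^ 2) * K := fun n x hx hxN => by
    have hi : (N n)⁻¹ ≤ 1 := inv_le_one_of_one_le₀ (hN1 n)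
    have hi0 : 0 ≤ (N n)⁻¹ := inv_nonneg.2 (hNpos n).le
    obtain ⟨k0, k1, k2⟩ := hK x hx
    have hχ1 := hχbd n x hx hxN
    have b1 : |ψ'' x * χ n x ^ 2| ≤ K := by
      rw [abs_mul, abs_pow]
      calc _ ≤ K * 1 ^ 2 := by gcongr
        _ = K := by ring
    have b2 : |4 * (N n)⁻¹ * (ψ' x * χ n x)| ≤ 4 * K := by
      rw [abs_mul, abs_mul, abs_mul, abs_of_nonneg hi0, abs_of_pos (four_pos : (0 : ℝ) < 4)]
      calc _ ≤ 4 * 1 * (K * 1) := by gcongr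
        _ = 4 * K := by ring
    have b3 : |2 * (N n)⁻¹ ^ 2 * ψ x| ≤ 2 * K := by
      rw [abs_mul, abs_mul, abs_pow, abs_of_nonneg hi0, abs_two]
      calc _ ≤ 2 * 1 ^ 2 * K := by gcongr
        _ = 2 * K := by ring
    have b4 : |(α : ℝ) ^ 2 * θ n x| ≤ (α : ℝ) ^ 2 * K := by
      rw [abs_mul, abs_of_nonneg (sq_nonneg (α : ℝ))]
      gcongr
      exact hbθ n x hx hxN
    refine (abs_sub _ _).trans ?_
    have := (abs_add_le (ψ'' x * χ n x ^ 2 - 4 * (N n)⁻¹ * (ψ' x * χ n x))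
      (2 * (N n)⁻¹ ^ 2 * ψ x)).trans (add_le_add_left (abs_sub _ _) _)
    simp only [hθ'']
    linarith
  have hlθ : ∀ x, Tendsto (fun n => θ n x) atTop (𝓝 (ψ x)) := fun x => by
    simpa using ((hχlim x).pow 2).const_mul (ψ x)
  have hlθ' : Tendsto (fun n => θ' n 0) atTop (𝓝 (ψ' 0)) := by
    simp [hθ', hχ, h0]
  have hlθ'' : ∀ x, Tendsto (fun n => θ'' n x) atTop (𝓝 (ψ'' x)) := fun x => by
    simpa [hθ''] using ((((hχlim x).pow 2).const_mul (ψ'' x)).sub ((hNinv.const_mul 4).mul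
      ((hχlim x).const_mul (ψ' x)))).add (((hNinv.pow 2).const_mul 2).mul_const (ψ x))
  have hlg : ∀ x, Tendsto (fun n => θ'' n x - (α : ℝ) ^ 2 * θ n x) atTop
      (𝓝 (ψ'' x - (α : ℝ) ^ 2 * ψ x)) := fun x =>
    (hlθ'' x).sub ((hlθ x).const_mul _)
  have hleft : Tendsto (fun n => ∫ x in (0 : ℝ)..N n, (u t₂ x - u t₁ x) * θ n x) atTop
      (𝓝 ((∫ x in Ioi (0 : ℝ), u t₂ x * ψ x) - ∫ x in Ioi (0 : ℝ), u t₁ x * ψ x)) := by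
    have i2 := (hM t₂ ht₂ le_rfl).1
    have i1 := (hM t₁ ht₁ ht).1
    have h := tendsto_intervalIntegral_mul (i2.sub i1) hcθ hNt (fun n => (hNpos n).le) hbθ
      fun x _ => hlθ x
    have bdd : ∀ {f : ℝ → ℝ}, IntegrableOn f (Ioi 0) →
        IntegrableOn (fun x => f x * ψ x) (Ioi 0) := fun hf => by
      refine hf.mul_bdd (c := K) hcψ.aestronglyMeasurable ?_
      filter_upwards [ae_restrict_mem measurableSet_Ioi] with x hx using (hK x (le_of_lt hx)).1
    rw [← integral_sub (bdd i2) (bdd i1)]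
    simpa only [sub_mul, Pi.sub_apply] using h
  have hright : Tendsto (fun n => ∫ s in t₁..t₂, ν * ((∫ x in (0 : ℝ)..N n,
      u s x * (θ'' n x - (α : ℝ) ^ 2 * θ n x)) + u s 0 * θ' n 0)) atTop
      (𝓝 (∫ s in t₁..t₂, ν * ((∫ x in Ioi (0 : ℝ), u s x * (ψ'' x - (α : ℝ) ^ 2 * ψ x)) +
        u s 0 * ψ' 0))) := by
    set U : ℝ → ℝ → ℝ := fun s z => u (max s t₁) (max z 0) with hU
    have hUc : Continuous fun p : ℝ × ℝ => U p.1 p.2 :=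
      continuous_clamp (f := fun p => u p.1 p.2)
        (hu.continuousOn.mono (prod_mono_left (Ici_subset_Ioi.2 ht₁)))
    have hU_eq : ∀ s ≥ t₁, ∀ x ≥ 0, U s x = u s x := fun s hs x hx => by
      simp only [hU]
      rw [max_eq_left hs, max_eq_left hx]
    have hU0 : Continuous fun s => U s 0 :=
      hUc.comp (f := fun s : ℝ => (s, (0 : ℝ))) (by fun_prop)
    refine intervalIntegral.tendsto_integral_filter_of_dominated_convergence
      (fun s => |ν| * ((7 + (α : ℝ) ^ 2) * K * M + |U s 0| * K))
      (Eventually.of_forall fun n => ?_) (Eventually.of_forall fun n => ?_) ?_ ?_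
    · have hcont : Continuous fun s => ν * ((∫ x in (0 : ℝ)..N n,
          U s x * (θ'' n x - (α : ℝ) ^ 2 * θ n x)) + U s 0 * θ' n 0) := by
        refine continuous_const.mul (Continuous.add ?_ (hU0.mul continuous_const))
        refine intervalIntegral.continuous_parametric_intervalIntegral_of_continuous' ?_ 0 (N n)
        exact hUc.mul (((hcθ'' n).sub (continuous_const.mul (hcθ n))).comp continuous_snd)
      refine hcont.aestronglyMeasurable.congr ?_
      rw [uIoc_of_le ht]
      filter_upwards [ae_restrict_mem measurableSet_Ioc] with s hs
      rw [hU_eq s hs.1.le 0 le_rfl]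
      congr 2
      refine intervalIntegral.integral_congr fun x hx => ?_
      rw [uIcc_of_le (hNpos n).le] at hx
      rw [hU_eq s hs.1.le x hx.1]
    · refine Eventually.of_forall fun s hs => ?_
      rw [uIoc_of_le ht] at hs
      obtain ⟨hi, hMs⟩ := hM s (ht₁.trans hs.1) hs.2
      rw [hU_eq s hs.1.le 0 le_rfl, norm_mul, Real.norm_eq_abs, Real.norm_eq_abs]
      refine mul_le_mul_of_nonneg_left ((abs_add_le _ _).trans (add_le_add ?_ ?_)) (abs_nonneg ν)
      · rw [intervalIntegral.integral_of_le (hNpos n).le]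
        have hsub : Ioc 0 (N n) ⊆ Ioi (0 : ℝ) := Ioc_subset_Ioi_self
        calc |∫ x in Ioc 0 (N n), u s x * (θ'' n x - (α : ℝ) ^ 2 * θ n x)|
            ≤ ∫ x in Ioc 0 (N n), (7 + (α : ℝ) ^ 2) * K * |u s x| := by
              rw [← Real.norm_eq_abs]
              refine norm_integral_le_of_norm_le ((hi.mono_set hsub).abs.const_mul _) ?_
              filter_upwards [ae_restrict_mem measurableSet_Ioc] with x hx
              rw [norm_mul, mul_comm, Real.norm_eq_abs, Real.norm_eq_abs]
              exact mul_le_mul_of_nonneg_right (hbg n x hx.1.le hx.2) (abs_nonneg _)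
          _ ≤ (7 + (α : ℝ) ^ 2) * K * M := by
              rw [integral_const_mul]
              refine mul_le_mul_of_nonneg_left (le_trans ?_ hMs) (by positivity)
              exact setIntegral_mono_set hi.abs (Eventually.of_forall fun x => abs_nonneg _)
                hsub.eventuallyLE
      · rw [abs_mul]
        refine mul_le_mul_of_nonneg_left ?_ (abs_nonneg _)
        simpa [hθ', hχ, h0] using (hK 0 le_rfl).2.1
    · exact (by fun_prop : Continuous fun s =>
        |ν| * ((7 + (α : ℝ) ^ 2) * K * M + |U s 0| * K)).intervalIntegrable _ _
    · refine Eventually.of_forall fun s hs => ?_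
      rw [uIoc_of_le ht] at hs
      refine Tendsto.const_mul ν (Tendsto.add ?_ (hlθ'.const_mul _))
      exact tendsto_intervalIntegral_mul (hM s (ht₁.trans hs.1) hs.2).1
        (fun n => (hcθ'' n).sub (continuous_const.mul (hcθ n))) hNt (fun n => (hNpos n).le) hbg
        fun x _ => hlg x
  refine tendsto_nhds_unique hleft (hright.congr fun n => ?_)
  exact (hu.weak_form_interval (hdθ n) (hdθ' n) (hcθ'' n) (hNpos n).le (by simp [hθ, h0])
    (by simp [hθ, hχN]) (by simp [hθ', hχN]) ht₁ ht).symm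

end WeakForm

/-! ### Uniqueness for the Stokes problem -/

section Uniqueness

variable {ν : ℝ} {α : ℤ} {u : ℝ → ℝ → ℝ}

theorem IsL1HeatSolution.sub {v : ℝ → ℝ → ℝ} (hu : IsL1HeatSolution ν α u)
    (hv : IsL1HeatSolution ν α v) : IsL1HeatSolution ν α fun t z => u t z - v t z := by
  have hd : ∀ t > 0, ∀ z > 0, HasDerivAt (fun s => u s z - v s z)
      (deriv (fun s => u s z) t - deriv (fun s => v s z) t) t := fun t ht z hz =>
    (hu.differentiableAt_time t ht z hz).hasDerivAt.sub
      (hv.differentiableAt_time t ht z hz).hasDerivAt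
  refine ⟨hu.continuousOn.sub hv.continuousOn, fun t ht z hz => (hd t ht z hz).differentiableAt,
    (hu.continuousOn_time_deriv.sub hv.continuousOn_time_deriv).congr fun p hp =>
      (hd p.1 hp.1 p.2 hp.2).deriv,
    fun t ht => (hu.contDiffOn_space t ht).sub (hv.contDiffOn_space t ht), fun t ht z hz => ?_,
    fun T hT => ?_⟩
  · have hn : Ioi (0 : ℝ) ∈ 𝓝 z := Ioi_mem_nhds hz
    have h := iteratedDeriv_sub (n := 2) ((hu.contDiffOn_space t ht).contDiffAt hn)
      ((hv.contDiffOn_space t ht).contDiffAt hn)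
    rw [(hd t ht z hz).deriv, hu.equation t ht z hz, hv.equation t ht z hz]
    change _ = ν * (iteratedDeriv 2 (u t - v t) z - _)
    rw [h]
    ring
  · obtain ⟨M, hM⟩ := hu.l1_bounded T hT
    obtain ⟨M', hM'⟩ := hv.l1_bounded T hT
    refine ⟨M + M', fun t ht htT => ?_⟩
    obtain ⟨i, h⟩ := hM t ht htT
    obtain ⟨i', h'⟩ := hM' t ht htT
    refine ⟨i.sub i', le_trans ?_ (add_le_add h h')⟩
    rw [← integral_add i.abs i'.abs]
    exact integral_mono (i.sub i').abs (i.abs.add i'.abs) fun z => abs_sub _ _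

theorem abs_integral_exp_mul_le {a : ℝ} (ha : 0 ≤ a) {f : ℝ → ℝ} (hf : IntegrableOn f (Ioi 0)) :
    IntegrableOn (fun z => Real.exp (-(a * z)) * f z) (Ioi 0) ∧
      |∫ z in Ioi (0 : ℝ), Real.exp (-(a * z)) * f z| ≤ ∫ z in Ioi (0 : ℝ), |f z| := by
  rw [← Real.norm_eq_abs]
  refine ⟨hf.bdd_mul (c := 1) measurable_exp_neg_mul.aestronglyMeasurable ?_,
    norm_integral_le_of_norm_le hf.abs ?_⟩
  · filter_upwards [ae_restrict_mem measurableSet_Ioi] with z hz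
      using abs_exp_neg_mul_le_one ha z hz
  · filter_upwards [ae_restrict_mem measurableSet_Ioi] with z hz
    rw [norm_mul, Real.norm_eq_abs, Real.norm_eq_abs]
    exact mul_le_of_le_one_left (abs_nonneg _) (abs_exp_neg_mul_le_one ha z hz)

/-- The test function `e^{-a|z|} - e^{-μ|z|}`, which vanishes at the boundary. -/
noncomputable def expDiffTest (a μ : ℝ) (ha : 0 ≤ a) (hμ : 0 ≤ μ) : ℝ →ᵇ ℝ :=
  BoundedContinuousFunction.ofNormedAddCommGroup
    (fun z => Real.exp (-(a * |z|)) - Real.exp (-(μ * |z|))) (by fun_prop) 2 fun z => by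
      have h : ∀ b : ℝ, 0 ≤ b → |Real.exp (-(b * |z|))| ≤ 1 := fun b hb => by
        rw [Real.abs_exp, Real.exp_le_one_iff]
        have : 0 ≤ b * |z| := by positivity
        linarith
      exact (abs_sub _ _).trans (by linarith [h a ha, h μ hμ])

/-- Tested with `e^{-az} - e^{-μz}`, `a = |α|`, the equation and the nonlocal boundary condition
close to an ordinary differential equation for `W = ∫ (e^{-az} - e^{-μz}) u dz`, driven by
`F = ∫ e^{-az} u dz`. -/
theorem IsL1HeatSolution.integral_expDiff_sub (hu : IsL1HeatSolution ν α u)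
    (hb : ∀ t > 0, ν * u t 0 = -∫ z in Ioi (0 : ℝ), Real.exp (-(|(α : ℝ)| * z)) * u t z)
    {μ : ℝ} (hμ : |(α : ℝ)| < μ) {t₁ t₂ : ℝ} (ht₁ : 0 < t₁) (ht : t₁ ≤ t₂) :
    (∫ z in Ioi (0 : ℝ), u t₂ z * (Real.exp (-(|(α : ℝ)| * z)) - Real.exp (-(μ * z)))) -
      ∫ z in Ioi (0 : ℝ), u t₁ z * (Real.exp (-(|(α : ℝ)| * z)) - Real.exp (-(μ * z))) =
    ∫ s in t₁..t₂, (ν * (μ ^ 2 - |(α : ℝ)| ^ 2) * (∫ z in Ioi (0 : ℝ), u s z *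
        (Real.exp (-(|(α : ℝ)| * z)) - Real.exp (-(μ * z)))) -
      (ν * (μ ^ 2 - |(α : ℝ)| ^ 2) + (μ - |(α : ℝ)|)) *
        ∫ z in Ioi (0 : ℝ), Real.exp (-(|(α : ℝ)| * z)) * u s z) := by
  set a := |(α : ℝ)| with ha
  have ha0 : 0 ≤ a := abs_nonneg _
  have hμ0 : 0 < μ := ha0.trans_lt hμ
  have hexp : ∀ b x : ℝ, HasDerivAt (fun x : ℝ => Real.exp (-(b * x)))
      (-b * Real.exp (-(b * x))) x := fun b x => by
    simpa using hasDerivAt_exp_mul (-b) x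
  have hψ : ∀ x, HasDerivAt (fun x => Real.exp (-(a * x)) - Real.exp (-(μ * x)))
      (-a * Real.exp (-(a * x)) - -μ * Real.exp (-(μ * x))) x := fun x =>
    (hexp a x).fun_sub (hexp μ x)
  have hψ' : ∀ x, HasDerivAt (fun x => -a * Real.exp (-(a * x)) - -μ * Real.exp (-(μ * x)))
      (a ^ 2 * Real.exp (-(a * x)) - μ ^ 2 * Real.exp (-(μ * x))) x := fun x => by
    refine (((hexp a x).const_mul (-a)).fun_sub ((hexp μ x).const_mul (-μ))).congr_deriv ?_
    ring
  have hK : ∀ x ≥ (0 : ℝ), |Real.exp (-(a * x)) - Real.exp (-(μ * x))| ≤ 2 * (1 + μ) ^ 2 ∧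
      |-a * Real.exp (-(a * x)) - -μ * Real.exp (-(μ * x))| ≤ 2 * (1 + μ) ^ 2 ∧
      |a ^ 2 * Real.exp (-(a * x)) - μ ^ 2 * Real.exp (-(μ * x))| ≤ 2 * (1 + μ) ^ 2 := by
    intro x hx
    have key : ∀ c d : ℝ, |c| ≤ (1 + μ) ^ 2 → |d| ≤ (1 + μ) ^ 2 →
        |c * Real.exp (-(a * x)) - d * Real.exp (-(μ * x))| ≤ 2 * (1 + μ) ^ 2 := by
      intro c d hc hd
      have e : ∀ b : ℝ, 0 ≤ b → Real.exp (-(b * x)) ≤ 1 := fun b hb =>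
        Real.exp_le_one_iff.2 (neg_nonpos.2 (mul_nonneg hb hx))
      refine (abs_sub _ _).trans ?_
      rw [abs_mul, abs_mul, Real.abs_exp, Real.abs_exp]
      have h1 := mul_le_mul hc (e a ha0) (Real.exp_pos _).le (by positivity)
      have h2 := mul_le_mul hd (e μ hμ0.le) (Real.exp_pos _).le (by positivity)
      linarith
    refine ⟨?_, key _ _ ?_ ?_, key _ _ ?_ ?_⟩
    · simpa using key 1 1 (by rw [abs_one]; nlinarith) (by rw [abs_one]; nlinarith)
    · rw [abs_neg, abs_of_nonneg ha0]
      nlinarith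
    · rw [abs_neg, abs_of_pos hμ0]
      nlinarith
    · rw [abs_of_nonneg (sq_nonneg a)]
      nlinarith
    · rw [abs_of_nonneg (sq_nonneg μ)]
      nlinarith
  rw [hu.weak_form hψ hψ' (by fun_prop) (by simp) hK ht₁ ht]
  refine intervalIntegral.integral_congr fun s hs => ?_
  rw [uIcc_of_le ht] at hs
  have hs0 : 0 < s := ht₁.trans_le hs.1
  obtain ⟨M, hM⟩ := hu.l1_bounded s hs0
  have hi := (hM s hs0 le_rfl).1
  have ia := (abs_integral_exp_mul_le ha0 hi).1
  have iμ := (abs_integral_exp_mul_le hμ0.le hi).1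
  have hα : (α : ℝ) ^ 2 = a ^ 2 := (sq_abs _).symm
  have e1 : ∫ z in Ioi (0 : ℝ), u s z * (a ^ 2 * Real.exp (-(a * z)) -
        μ ^ 2 * Real.exp (-(μ * z)) - (α : ℝ) ^ 2 * (Real.exp (-(a * z)) - Real.exp (-(μ * z)))) =
      -(μ ^ 2 - a ^ 2) * ∫ z in Ioi (0 : ℝ), Real.exp (-(μ * z)) * u s z := by
    rw [← integral_const_mul, hα]
    congr 1
    funext z
    ring
  have e2 : ∫ z in Ioi (0 : ℝ), u s z * (Real.exp (-(a * z)) - Real.exp (-(μ * z))) =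
      (∫ z in Ioi (0 : ℝ), Real.exp (-(a * z)) * u s z) -
        ∫ z in Ioi (0 : ℝ), Real.exp (-(μ * z)) * u s z := by
    rw [← integral_sub ia iμ]
    congr 1
    funext z
    ring
  have h := hb s hs0
  simp only [mul_zero, neg_zero, Real.exp_zero, mul_one]
  rw [e1, e2]
  linear_combination (μ - a) * h

theorem integrableOn_Ioc_of_bounded {F : ℝ → ℝ} (hF : ContinuousOn F (Ioi 0)) {T B : ℝ}
    (hB : ∀ t, 0 < t → t ≤ T → |F t| ≤ B) : IntegrableOn F (Ioc 0 T) := by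
  refine Integrable.mono' (g := fun _ => B) (integrableOn_const (by simp))
    ((hF.mono Ioc_subset_Ioi_self).aestronglyMeasurable measurableSet_Ioc) ?_
  filter_upwards [ae_restrict_mem measurableSet_Ioc] with s hs using hB s hs.1 hs.2

/-- An integrable `F` whose truncated exponential moments `∫_0^T e^{n(T-s)} F(s) ds` are bounded
in `n` vanishes. -/
theorem eq_zero_of_convolution_bounded {F : ℝ → ℝ} (hF : ContinuousOn F (Ioi 0)) {T : ℝ}
    (hint : IntegrableOn F (Ioc 0 T)) {M : ℝ}
    (hM : ∀ n : ℕ, 1 ≤ n → |∫ s in (0 : ℝ)..T, Real.exp (n * (T - s)) * F s| ≤ M)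
    {t : ℝ} (ht : 0 < t) (htT : t < T) : F t = 0 := by
  have hT : 0 ≤ T := (ht.trans htT).le
  set f : ℝ → ℝ := fun s => (Ioc 0 T).indicator F (T - s) with hf
  have hfi : Integrable f := by
    have h := (integrable_indicator_iff measurableSet_Ioc).2 hint
    exact h.comp_sub_left T
  have hS : ∀ s > T, f s = 0 := fun s hs => by
    refine indicator_of_notMem (fun h => ?_) _
    linarith [h.1]
  have hmom : ∀ n : ℕ, 1 ≤ n → |∫ s, Real.exp (n * s) * f s| ≤ M * Real.exp (n * 0) := by
    intro n hn
    rw [mul_zero, Real.exp_zero, mul_one]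
    refine le_of_eq_of_le ?_ (hM n hn)
    congr 1
    rw [← integral_sub_left_eq_self _ volume T, intervalIntegral.integral_of_le hT,
      ← integral_indicator measurableSet_Ioc]
    congr 1
    funext s
    simp only [hf, sub_sub_cancel]
    by_cases h : s ∈ Ioc 0 T
    · rw [indicator_of_mem h, indicator_of_mem h]
    · rw [indicator_of_notMem h, indicator_of_notMem h, mul_zero]
  have hev : (fun s => F (T - s)) =ᶠ[𝓝 (T - t)] f := by
    filter_upwards [Ioo_mem_nhds (show 0 < T - t by linarith) (show T - t < T by linarith)] with s hs
    exact (indicator_of_mem (show T - s ∈ Ioc 0 T from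
      ⟨by linarith [hs.2], by linarith [hs.1]⟩) _).symm
  have hc : ContinuousAt f (T - t) := by
    refine ContinuousAt.congr ?_ hev
    have h1 : ContinuousAt F (T - (T - t)) := by
      rw [sub_sub_cancel]
      exact hF.continuousAt (Ioi_mem_nhds ht)
    exact ContinuousAt.comp (f := fun s => T - s) h1 (by fun_prop)
  have h := eq_zero_of_exp_moments hfi hS hmom (show 0 < T - t by linarith) hc
  rw [← hev.eq_of_nhds] at h
  simpa using h

/-- The variation-of-constants formula for `W' = κ W - c F` with vanishing initial value, stated
for the integrated equation. -/
theorem exp_neg_mul_eq_of_integral_eq {W F : ℝ → ℝ} {κ c T B : ℝ} (hT : 0 < T)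
    (hFc : ContinuousOn F (Ioi 0)) (hWB : ∀ t, 0 < t → t ≤ T → |W t| ≤ B)
    (hFB : ∀ t, 0 < t → t ≤ T → |F t| ≤ B)
    (hW : ∀ t₁ t₂, 0 < t₁ → t₁ ≤ t₂ → t₂ ≤ T →
      W t₂ - W t₁ = ∫ s in t₁..t₂, (κ * W s - c * F s))
    (h0 : Tendsto W (𝓝[>] 0) (𝓝 0)) :
    Real.exp (-(κ * T)) * W T = -c * ∫ s in (0 : ℝ)..T, Real.exp (-(κ * s)) * F s := by
  have hB : 0 ≤ B := (abs_nonneg _).trans (hWB T hT le_rfl)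
  set L := |κ| * B + |c| * B with hL
  have hbd : ∀ s, 0 < s → s ≤ T → ‖κ * W s - c * F s‖ ≤ L := fun s hs hsT => by
    refine (abs_sub _ _).trans ?_
    rw [abs_mul, abs_mul]
    exact add_le_add (mul_le_mul_of_nonneg_left (hWB s hs hsT) (abs_nonneg _))
      (mul_le_mul_of_nonneg_left (hFB s hs hsT) (abs_nonneg _))
  -- the bound of the integral needs no measurability of `W`, whose continuity follows from it
  have hlip : ∀ t₁ t₂, 0 < t₁ → t₁ ≤ t₂ → t₂ ≤ T → |W t₂ - W t₁| ≤ L * |t₂ - t₁| := by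
    intro t₁ t₂ h1 h12 h2
    rw [hW t₁ t₂ h1 h12 h2, ← Real.norm_eq_abs]
    refine intervalIntegral.norm_integral_le_of_norm_le_const fun s hs => ?_
    rw [uIoc_of_le h12] at hs
    exact hbd s (h1.trans hs.1) (hs.2.trans h2)
  have hWc : ContinuousOn W (Ioc 0 T) := by
    have hL0 : 0 ≤ L := by positivity
    refine (LipschitzOnWith.of_dist_le_mul (K := ⟨L, hL0⟩) fun x hx y hy => ?_).continuousOn
    rw [Real.dist_eq, Real.dist_eq]
    rcases le_total x y with h | h
    · rw [abs_sub_comm, abs_sub_comm x]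
      exact hlip x y hx.1 h hy.2
    · exact hlip y x hy.1 h hx.2
  have hFc' : ContinuousOn F (Ioc 0 T) := hFc.mono Ioc_subset_Ioi_self
  have hgc : ContinuousOn (fun s => κ * W s - c * F s) (Ioc 0 T) :=
    (continuousOn_const.mul hWc).sub (continuousOn_const.mul hFc')
  have hexp : ∀ x : ℝ, HasDerivAt (fun x : ℝ => Real.exp (-(κ * x)))
      (-κ * Real.exp (-(κ * x))) x := fun x => by
    simpa using hasDerivAt_exp_mul (-κ) x
  have hstep : ∀ t₁, 0 < t₁ → t₁ ≤ T → Real.exp (-(κ * T)) * W T - Real.exp (-(κ * t₁)) * W t₁ =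
      ∫ s in t₁..T, -c * (Real.exp (-(κ * s)) * F s) := by
    intro t₁ h1 h1T
    have hsub : Icc t₁ T ⊆ Ioc 0 T := fun s hs => ⟨h1.trans_le hs.1, hs.2⟩
    refine (intervalIntegral.integral_eq_sub_of_hasDerivAt_of_le h1T
      (((by fun_prop : Continuous fun s : ℝ => Real.exp (-(κ * s))).continuousOn).mul
        (hWc.mono hsub)) (fun s hs => ?_) ?_).symm
    · have hsI : Ioc 0 T ∈ 𝓝 s :=
        mem_of_superset (Ioo_mem_nhds (h1.trans hs.1) hs.2) Ioo_subset_Ioc_self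
      have hd : HasDerivAt W (κ * W s - c * F s) s := by
        have hii : IntervalIntegrable (fun s => κ * W s - c * F s) volume t₁ s := by
          refine (hgc.mono fun r hr => ?_).intervalIntegrable
          rw [uIcc_of_le hs.1.le] at hr
          exact ⟨h1.trans_le hr.1, hr.2.trans hs.2.le⟩
        have h := intervalIntegral.integral_hasDerivAt_right hii
          (hgc.stronglyMeasurableAtFilter_nhdsWithin measurableSet_Ioc s |>.filter_mono
            (by rw [nhdsWithin_eq_nhds.2 hsI])) (hgc.continuousAt hsI)
        refine (h.add_const (W t₁)).congr_of_eventuallyEq ?_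
        filter_upwards [Ioo_mem_nhds hs.1 hs.2] with r hr
        rw [← hW t₁ r h1 hr.1.le hr.2.le]
        ring
      refine ((hexp s).fun_mul hd).congr_deriv ?_
      ring
    · refine ContinuousOn.intervalIntegrable ?_
      rw [uIcc_of_le h1T]
      exact continuousOn_const.mul ((by fun_prop : Continuous fun s : ℝ =>
        Real.exp (-(κ * s))).continuousOn.mul (hFc'.mono hsub))
  have hint : IntervalIntegrable (fun s => -c * (Real.exp (-(κ * s)) * F s)) volume 0 T := by
    rw [intervalIntegrable_iff_integrableOn_Ioc_of_le hT.le]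
    have hm := integrableOn_Ioc_of_bounded hFc hFB
    have hce : Continuous fun s : ℝ => Real.exp (-(κ * s)) := by fun_prop
    exact (hm.continuousOn_mul_of_subset hce.continuousOn isCompact_Icc
      measurableSet_Ioc Ioc_subset_Icc_self).const_mul _
  have hprim : Tendsto (fun t₁ => ∫ s in t₁..T, -c * (Real.exp (-(κ * s)) * F s)) (𝓝[>] 0)
      (𝓝 (∫ s in (0 : ℝ)..T, -c * (Real.exp (-(κ * s)) * F s))) := by
    have h := intervalIntegral.continuousOn_primitive_interval_left
      (f := fun s => -c * (Real.exp (-(κ * s)) * F s)) (a := 0) (b := T) (μ := volume) (by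
        rw [uIcc_of_le hT.le, integrableOn_Icc_iff_integrableOn_Ioc]
        exact (intervalIntegrable_iff_integrableOn_Ioc_of_le hT.le).1 hint)
    rw [uIcc_of_le hT.le] at h
    refine (h 0 (left_mem_Icc.2 hT.le)).mono_left ?_
    rw [nhdsWithin_Icc_eq_nhdsGE hT]
    exact nhdsWithin_mono _ Ioi_subset_Ici_self
  have hleft : Tendsto (fun t₁ => Real.exp (-(κ * T)) * W T - Real.exp (-(κ * t₁)) * W t₁) (𝓝[>] 0)
      (𝓝 (Real.exp (-(κ * T)) * W T)) := by
    have hc : Tendsto (fun t : ℝ => Real.exp (-(κ * t))) (𝓝[>] 0) (𝓝 (Real.exp (-(κ * 0)))) :=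
      ((by fun_prop : Continuous fun t : ℝ => Real.exp (-(κ * t))).tendsto 0).mono_left
        nhdsWithin_le_nhds
    simpa using (hc.mul h0).const_sub (Real.exp (-(κ * T)) * W T)
  rw [← intervalIntegral.integral_const_mul]
  refine tendsto_nhds_unique hleft (hprim.congr' ?_)
  filter_upwards [Ioo_mem_nhdsGT hT] with t₁ h1 using (hstep t₁ h1.1 h1.2.le).symm

/-- Homogeneous uniqueness. The variation-of-constants formula for the tests
`e^{-az} - e^{-μz}` bounds `∫_0^T e^{κ(T-s)} F(s) ds` for arbitrarily large `κ`, which forces the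
boundary trace `F` to vanish; then all Laplace transforms of the solution vanish. -/
theorem IsL1HeatSolution.eq_zero (hν : 0 < ν) (hu : IsL1HeatSolution ν α u)
    (hb : ∀ t > 0, ν * u t 0 = -∫ z in Ioi (0 : ℝ), Real.exp (-(|(α : ℝ)| * z)) * u t z)
    (h0 : ∀ φ : ℝ →ᵇ ℝ, φ 0 = 0 →
      Tendsto (fun t => ∫ z in Ioi (0 : ℝ), u t z * φ z) (𝓝[>] 0) (𝓝 0))
    {t z : ℝ} (ht : 0 < t) (hz : 0 ≤ z) : u t z = 0 := by
  set a := |(α : ℝ)| with ha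
  have ha0 : 0 ≤ a := abs_nonneg _
  set F : ℝ → ℝ := fun t => ∫ z in Ioi (0 : ℝ), Real.exp (-(a * z)) * u t z with hF
  set W : ℝ → ℝ → ℝ := fun μ t =>
    ∫ z in Ioi (0 : ℝ), u t z * (Real.exp (-(a * z)) - Real.exp (-(μ * z))) with hW
  have hFc : ContinuousOn F (Ioi 0) := by
    have h1 : ContinuousOn (fun t => u t 0) (Ioi 0) :=
      hu.continuousOn.comp (f := fun t : ℝ => (t, (0 : ℝ))) (by fun_prop)
        fun t ht => ⟨ht, self_mem_Ici⟩
    refine ContinuousOn.congr (f := fun t => -ν * u t 0) (continuousOn_const.mul h1)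
      fun t ht => ?_
    have := hb t ht
    simp only [hF]
    linarith
  have hWeq : ∀ μ, 0 ≤ μ → ∀ t > 0,
      W μ t = F t - ∫ z in Ioi (0 : ℝ), Real.exp (-(μ * z)) * u t z := by
    intro μ hμ t ht
    obtain ⟨M, hM⟩ := hu.l1_bounded t ht
    have hi := (hM t ht le_rfl).1
    simp only [hW, hF]
    rw [← integral_sub (abs_integral_exp_mul_le ha0 hi).1 (abs_integral_exp_mul_le hμ hi).1]
    congr 1
    funext z
    ring
  have hbound : ∀ T > 0, ∃ B, 0 ≤ B ∧ (∀ t, 0 < t → t ≤ T → |F t| ≤ B) ∧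
      ∀ μ, 0 ≤ μ → ∀ t, 0 < t → t ≤ T → |W μ t| ≤ B := by
    intro T hT
    obtain ⟨M, hM⟩ := hu.l1_bounded T hT
    have hM0 : 0 ≤ M := (integral_nonneg fun z => abs_nonneg _).trans (hM T hT le_rfl).2
    refine ⟨2 * M, by positivity, fun t ht htT => ?_, fun μ hμ t ht htT => ?_⟩
    · obtain ⟨hi, h⟩ := hM t ht htT
      linarith [(abs_integral_exp_mul_le ha0 hi).2]
    · obtain ⟨hi, h⟩ := hM t ht htT
      rw [hWeq μ hμ t ht]
      have h1 := (abs_integral_exp_mul_le ha0 hi).2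
      have h2 := (abs_integral_exp_mul_le hμ hi).2
      exact (abs_sub _ _).trans (by linarith)
  have hduhamel : ∀ μ, a < μ → ∀ T > 0,
      Real.exp (-(ν * (μ ^ 2 - a ^ 2) * T)) * W μ T =
        -(ν * (μ ^ 2 - a ^ 2) + (μ - a)) *
          ∫ s in (0 : ℝ)..T, Real.exp (-(ν * (μ ^ 2 - a ^ 2) * s)) * F s := by
    intro μ hμ T hT
    have hμ0 : 0 ≤ μ := ha0.trans hμ.le
    obtain ⟨B, -, hFB, hWB⟩ := hbound T hT
    refine exp_neg_mul_eq_of_integral_eq hT hFc (hWB μ hμ0) hFB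
      (fun t₁ t₂ h1 h12 _ => hu.integral_expDiff_sub hb hμ h1 h12) ?_
    refine (h0 (expDiffTest a μ ha0 hμ0) (by simp [expDiffTest])).congr fun t => ?_
    refine setIntegral_congr_fun measurableSet_Ioi fun z hz => ?_
    simp [expDiffTest, abs_of_pos (show 0 < z from hz)]
  have hFzero : ∀ t > 0, F t = 0 := by
    intro t ht
    set T := t + 1 with hT
    have hT0 : 0 < T := by positivity
    obtain ⟨B, hB, hFB, hWB⟩ := hbound T hT0
    have hint := integrableOn_Ioc_of_bounded hFc hFB
    refine eq_zero_of_convolution_bounded hFc hint (M := B) (fun n hn => ?_) ht (by linarith)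
    -- the rate `μ` for which the growth rate `ν (μ² - a²)` is `n`
    set μ := Real.sqrt (a ^ 2 + n / ν) with hμ
    have hn0 : (1 : ℝ) ≤ n := by exact_mod_cast hn
    have hsq : μ ^ 2 = a ^ 2 + n / ν := Real.sq_sqrt (by positivity)
    have haμ : a < μ := by
      refine Real.lt_sqrt_of_sq_lt ?_
      have : 0 < (n : ℝ) / ν := by positivity
      linarith
    have hκ : ν * (μ ^ 2 - a ^ 2) = n := by
      rw [hsq]
      field_simp
      ring
    have h := hduhamel μ haμ T hT0
    rw [hκ] at h
    have e : ∫ s in (0 : ℝ)..T, Real.exp (n * (T - s)) * F s =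
        Real.exp (n * T) * ∫ s in (0 : ℝ)..T, Real.exp (-(n * s)) * F s := by
      rw [← intervalIntegral.integral_const_mul]
      congr 1
      funext s
      rw [← mul_assoc, ← Real.exp_add]
      ring_nf
    have hexp : Real.exp (n * T) * Real.exp (-(n * T)) = 1 := by
      rw [← Real.exp_add, add_neg_cancel, Real.exp_zero]
    have e2 : W μ T = -((n : ℝ) + (μ - a)) *
        ∫ s in (0 : ℝ)..T, Real.exp (n * (T - s)) * F s := by
      rw [e]
      linear_combination (-W μ T) * hexp + Real.exp (n * T) * h
    have h1 := hWB μ (ha0.trans haμ.le) T hT0 le_rfl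
    rw [e2, abs_mul, abs_neg, abs_of_pos (show 0 < (n : ℝ) + (μ - a) by linarith)] at h1
    refine le_trans (le_mul_of_one_le_left (abs_nonneg _) ?_) h1
    linarith
  have hlaplace : ∀ μ, a < μ → ∫ z in Ioi (0 : ℝ), Real.exp (-(μ * z)) * u t z = 0 := by
    intro μ hμ
    have h := hduhamel μ hμ t ht
    have hz : ∫ s in (0 : ℝ)..t, Real.exp (-(ν * (μ ^ 2 - a ^ 2) * s)) * F s = 0 := by
      rw [intervalIntegral.integral_of_le ht.le]
      refine setIntegral_eq_zero_of_forall_eq_zero fun s hs => ?_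
      rw [hFzero s hs.1, mul_zero]
    rw [hz, mul_zero, hWeq μ (ha0.trans hμ.le) t ht, hFzero t ht, zero_sub, mul_neg,
      neg_eq_zero] at h
    exact (mul_eq_zero.1 h).resolve_left (Real.exp_pos _).ne'
  obtain ⟨M, hM⟩ := hu.l1_bounded t ht
  have hi := (hM t ht le_rfl).1
  have hpos : ∀ z > 0, u t z = 0 := by
    intro z hz
    set f : ℝ → ℝ := fun s => (Ioi (0 : ℝ)).indicator (fun z => Real.exp (-(a * z)) * u t z) (-s)
      with hf
    have hfi : Integrable f :=
      ((integrable_indicator_iff measurableSet_Ioi).2 (abs_integral_exp_mul_le ha0 hi).1).comp_neg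
    have hS : ∀ s > 0, f s = 0 := fun s hs => indicator_of_notMem (by simpa using le_of_lt hs) _
    have hmom : ∀ n : ℕ, 1 ≤ n → |∫ s, Real.exp (n * s) * f s| ≤ 0 * Real.exp (n * (-z - 1)) := by
      intro n hn
      have hn0 : (1 : ℝ) ≤ n := by exact_mod_cast hn
      rw [zero_mul, ← integral_neg_eq_self]
      refine le_of_eq ?_
      rw [abs_eq_zero, ← hlaplace (a + n) (by linarith), ← integral_indicator measurableSet_Ioi]
      congr 1
      funext s
      simp only [hf, neg_neg]
      by_cases h : s ∈ Ioi (0 : ℝ)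
      · rw [indicator_of_mem h, indicator_of_mem h, ← mul_assoc, ← Real.exp_add]
        ring_nf
      · rw [indicator_of_notMem h, indicator_of_notMem h, mul_zero]
    have hev : (fun s => Real.exp (-(a * -s)) * u t (-s)) =ᶠ[𝓝 (-z)] f := by
      filter_upwards [Iio_mem_nhds (show -z < 0 by linarith)] with s hs
      exact (indicator_of_mem (show -s ∈ Ioi (0 : ℝ) by simpa using hs)
        (fun z => Real.exp (-(a * z)) * u t z)).symm
    have hc : ContinuousAt f (-z) := by
      refine ContinuousAt.congr (ContinuousAt.mul (by fun_prop) ?_) hev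
      have h1 : ContinuousAt (u t) (- -z) := by
        rw [neg_neg]
        exact (hu.contDiffOn_space t ht).continuousOn.continuousAt (Ioi_mem_nhds hz)
      exact ContinuousAt.comp (f := fun s => -s) h1 (by fun_prop)
    have h := eq_zero_of_exp_moments hfi hS hmom (show -z - 1 < -z by linarith) hc
    rw [← hev.eq_of_nhds, neg_neg] at h
    exact (mul_eq_zero.1 h).resolve_left (Real.exp_pos _).ne'
  -- the value at `z = 0` is given by the boundary condition
  rcases hz.eq_or_lt with rfl | hz
  · have h1 := hb t ht
    have h2 : (∫ z in Ioi (0 : ℝ), Real.exp (-(a * z)) * u t z) = 0 := hFzero t ht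
    rw [h2, neg_zero] at h1
    exact (mul_eq_zero.1 h1).resolve_left hν.ne'
  · exact hpos z hz

theorem IsStokesGreen.eq {G G' : ℝ → ℝ → ℝ → ℝ} (hν : 0 < ν) (hG : IsStokesGreen ν α G)
    (hG' : IsStokesGreen ν α G') {t z y : ℝ} (ht : 0 < t) (hz : 0 ≤ z) (hy : 0 ≤ y) :
    G' t z y = G t z y := by
  have hint : ∀ {g : ℝ → ℝ → ℝ}, IsL1HeatSolution ν α g → ∀ t > 0, IntegrableOn (g t) (Ioi 0) :=
    fun hg t ht => ((hg.l1_bounded t ht).choose_spec t ht le_rfl).1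
  have hu := (hG'.solution y hy).sub (hG.solution y hy)
  refine sub_eq_zero.1 (hu.eq_zero hν (fun t ht => ?_) (fun φ hφ => ?_) ht hz)
  · have i' := (abs_integral_exp_mul_le (abs_nonneg (α : ℝ)) (hint (hG'.solution y hy) t ht)).1
    have i := (abs_integral_exp_mul_le (abs_nonneg (α : ℝ)) (hint (hG.solution y hy) t ht)).1
    simp only [mul_sub]
    rw [integral_sub i' i, hG'.boundary y hy t ht, hG.boundary y hy t ht]
    ring
  · have h := (hG'.initial y hy φ fun _ => hφ).sub (hG.initial y hy φ fun _ => hφ)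
    rw [sub_self] at h
    refine h.congr' ?_
    filter_upwards [self_mem_nhdsWithin] with t ht
    have bdd : ∀ {f : ℝ → ℝ}, IntegrableOn f (Ioi 0) →
        IntegrableOn (fun x => f x * φ x) (Ioi 0) := fun hf =>
      hf.mul_bdd φ.continuous.aestronglyMeasurable (Eventually.of_forall φ.norm_coe_le_norm)
    rw [← integral_sub (bdd (hint (hG'.solution y hy) t ht))
      (bdd (hint (hG.solution y hy) t ht))]
    simp only [sub_mul]

end Uniqueness

/-! ### The Green function and its residual part -/

theorem inv_sqrt_pow_succ {τ : ℝ} (hτ : 0 < τ) (k : ℕ) :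
    (Real.sqrt τ)⁻¹ ^ (k + 1) = τ ^ (-(k : ℝ) / 2) * τ ^ (-(1 : ℝ) / 2) := by
  have h : (Real.sqrt τ)⁻¹ = τ ^ (-(1 : ℝ) / 2) := by
    rw [Real.sqrt_eq_rpow, ← Real.rpow_neg hτ.le]
    norm_num
  rw [h, ← Real.rpow_natCast, ← Real.rpow_mul hτ.le, ← Real.rpow_add hτ]
  congr 1
  push_cast
  ring

theorem contDiff_stokesR {ν : ℝ} (hν : 0 < ν) (α : ℤ) {t y : ℝ} (ht : 0 < t) (hy : 0 ≤ y) :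
    ContDiff ℝ ∞ fun z => stokesR ν α t z y :=
  contDiff_const.mul ((heatJet_residualJet (abs_nonneg (α : ℝ)) (inv_pos.2 hν) hy).contDiff
    (mul_pos hν ht))

theorem abs_iteratedDerivWithin_stokesR_le {ν : ℝ} (hν : 0 < ν) (α : ℤ) {t y z : ℝ} (ht : 0 < t)
    (hy : 0 ≤ y) (hz : 0 ≤ z) (k : ℕ) :
    |iteratedDerivWithin k (fun z => stokesR ν α t z y) (Ici 0) z| ≤
      (2 * gaussConst k + 2 * (gaussConst (k + 1) * Real.sqrt (8 * Real.pi))) *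
        ((ν * t) ^ (-(k : ℝ) / 2) * Real.exp (-(1 / 2 * (α : ℝ) ^ 2 * ν * t)) *
          ((ν * t) ^ (-(1 : ℝ) / 2) * Real.exp (-(1 / 2 * (z ^ 2 / (4 * ν * t)))))) := by
  have hτ : 0 < ν * t := mul_pos hν ht
  have hc : 0 < ν⁻¹ := inv_pos.2 hν
  have hjet := heatJet_residualJet (abs_nonneg (α : ℝ)) hc hy
  have hk : ContDiff ℝ k fun z => stokesR ν α t z y :=
    contDiff_infty.1 (contDiff_stokesR hν α ht hy) k
  rw [iteratedDerivWithin_eq_iteratedDeriv (uniqueDiffOn_Ici 0) hk.contDiffAt hz]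
  have e : iteratedDeriv k (fun z => stokesR ν α t z y) z =
      Real.exp (-((α : ℝ) ^ 2 * ν * t)) * residualJet |(α : ℝ)| ν⁻¹ y k (ν * t) z :=
    congrFun ((hjet.const_mul (Real.exp (-((α : ℝ) ^ 2 * ν * t)))).iteratedDeriv_eq hτ k) z
  have h1 := abs_residualJet_le (abs_nonneg (α : ℝ)) hc hy k hτ hz
  have h2 : Real.exp (-((α : ℝ) ^ 2 * ν * t)) ≤ Real.exp (-(1 / 2 * (α : ℝ) ^ 2 * ν * t)) := by
    refine Real.exp_le_exp.2 ?_
    have : 0 ≤ (α : ℝ) ^ 2 * ν * t := by positivity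
    linarith
  have h3 : z ^ 2 / (8 * (ν * t)) = 1 / 2 * (z ^ 2 / (4 * ν * t)) := by
    field_simp
    ring
  rw [inv_sqrt_pow_succ hτ, h3] at h1
  rw [e, abs_mul, Real.abs_exp]
  refine (mul_le_mul h2 h1 (abs_nonneg _) (Real.exp_pos _).le).trans_eq ?_
  ring

theorem proposition5p3 :
    (∀ ν : ℝ, 0 < ν → ∀ α : ℤ, ∃ G : ℝ → ℝ → ℝ → ℝ, IsStokesGreen ν α G ∧
      ∀ G' : ℝ → ℝ → ℝ → ℝ, IsStokesGreen ν α G' →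
        ∀ t > 0, ∀ z ≥ 0, ∀ y ≥ 0, G' t z y = G t z y) ∧
    (∀ ν : ℝ, 0 < ν → ∀ α : ℤ, IsNeumannGreen ν α (stokesH ν α)) ∧
    ∃ θ₀ : ℝ, 0 < θ₀ ∧ ∃ C : ℕ → ℝ, ∀ ν : ℝ, 0 < ν → ∀ α : ℤ,
      ∀ G : ℝ → ℝ → ℝ → ℝ, IsStokesGreen ν α G →
        ∃ R : ℝ → ℝ → ℝ → ℝ,
          (∀ t > 0, ∀ z ≥ 0, ∀ y ≥ 0, G t z y = stokesH ν α t z y + R t z y) ∧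
          ∀ t > 0, ∀ y ≥ 0,
            ContDiffOn ℝ ∞ (fun z => R t z y) (Ici 0) ∧
            ∀ k : ℕ, ∀ z ≥ 0,
              |iteratedDerivWithin k (fun z => R t z y) (Ici 0) z| ≤
                C k * ((ν * t) ^ (-(k : ℝ) / 2) * Real.exp (-(θ₀ * (α : ℝ) ^ 2 * ν * t)) *
                  ((ν * t) ^ (-(1 : ℝ) / 2) * Real.exp (-(θ₀ * (z ^ 2 / (4 * ν * t)))))) := by
  refine ⟨fun ν hν α => ⟨_, isStokesGreen_stokesH_add_stokesR hν α, fun G' hG' t ht z hz y hy =>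
    (isStokesGreen_stokesH_add_stokesR hν α).eq hν hG' ht hz hy⟩,
    fun ν hν α => isNeumannGreen_stokesH hν α, 1 / 2, by norm_num, _, fun ν hν α G hG =>
    ⟨stokesR ν α, fun t ht z hz y hy =>
      (isStokesGreen_stokesH_add_stokesR hν α).eq hν hG ht hz hy, fun t ht y hy =>
      ⟨(contDiff_stokesR hν α ht hy).contDiffOn, fun k z hz =>
        abs_iteratedDerivWithin_stokesR_le hν α ht hy hz k⟩⟩⟩
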